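/- Throughout, $\log=\log_2$. An encoding circuit of depth $d$ that encodes $k\ge 1$ logical qubits into $n$ physical qubits is a unitary $U=U_d\cdots U_1$ on $n$ qubits, each layer $U_t$ being a product of one- and two-qubit gates with pairwise disjoint supports, together with a choice of $k$ of the $n$ qubits that carry the logical state; the other $n-k$ qubits start in $|0\rangle$. It gives the encoding channel $\mathcal E(\rho)=U(\rho\otimes|0^{n-k}\rangle\langle 0^{n-k}|)U^\dagger$. The circuit is $D$-dimensional ($D\ge1$) if the qubits can be placed on distinct sites of a $D$-dimensional grid (each direction being open or periodic) so that every two-qubit gate acts on nearest neighbours. An all-to-all circuit has no restriction on which pairs of qubits interact. Let $\mathcal N$ be the strength-$p$ local depolarizing channel, i.e. the $n$-fold tensor power of $\rho\mapsto(1-p)\rho+p\,\mathrm{tr}(\rho)\,\mathbb I/2$, with $0<p\le 1$. With $F(\rho,\sigma)=\mathrm{tr}\sqrt{\sqrt\rho\,\sigma\sqrt\rho}$ and $\hat\phi_{LR}$ the maximally entangled state of the $k$ logical qubits $L$ and a $k$-qubit reference $R$, the Choi error is $$\epsilon=\sqrt{1-F_{\rm Choi}^2},\qquad F_{\rm Choi}=\max_{\mathcal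 D}F\big(\hat\phi_{LR},[(\mathcal D\circ\mathcal N\circ\mathcal E)_L\otimes I_R](\hat\phi_{LR})\big),$$ the maximum being over all decoding channels $\mathcal D$ (completely positive trace-preserving maps from $n$ to $k$ qubits). **Theorem (Lower bound for circuit depth).** Fix $0<p\le1$. 1. If the circuit is $D$-dimensional with depth $d\ge1$ and $\epsilon<0.1$, then $\epsilon>0$ and $$(2d)^D\log\frac1p+2D\log(2d)\ \ge\ \log\frac{3}{8\epsilon^2}+\log k .$$ Consequently, for fixed $p<1$ and $D$, $$d\ \ge\ \frac12\left[\frac{\log\frac{3}{8\epsilon^2}+\log k}{(1+o(1))\log\frac1p}\right]^{1/D},$$ where $o(1)$ is a nonnegative function of $d$ alone (for the fixed $p$ and $D$) that tends to $0$ as $d\to\infty$. 2. If the circuit is all-to-all, of any depth $d\ge0$, and $\epsilon<0.1$, then $\epsilon>0$ and $$2^d\log\frac1p+2d\ \ge\ \log\frac{3}{8\epsilon^2}+\log k .$$ Consequently, for fixed $p<1$, $$d\ \ge\ \log\left[\frac{\log\frac{3}{8\epsilon^2}+\log k}{(1+o(1))\log\frac1p}\right],$$ where $o(1)$ is a nonnegative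 function of $d$ alone (for the fixed $p$) that tends to $0$ as $d\to\infty$. 3. In particular, for fixed $p$, one-dimensional circuits need depth $\Omega(\log n)$ both for a polynomially small Choi error and for a constant encoding rate: (a) for all $\alpha,A>0$ there are $c>0$ and $N$ such that for $n\ge N$ every one-dimensional encoding circuit of $k\ge1$ logical qubits into $n$ qubits with $\epsilon\le A n^{-\alpha}$ has depth $d\ge c\log n$; (b) for every $r>0$ there are $c>0$ and $N$ such that for $n\ge N$ every one-dimensional encoding circuit with $k\ge rn$ and $\epsilon<0.1$ has depth $d\ge c\log n$. -/

import Mathlib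

open scoped Matrix MatrixOrder ComplexOrder

noncomputable section

/-- Computational basis labels of a register of qubits indexed by `Q`; an operator on the register
is a matrix indexed by `Bits Q`. -/
abbrev Bits (Q : Type) : Type := Q → Fin 2

/-! ### States, channels, fidelity -/

/-- `Φ ⊗ id_R`, where the reference system `R` is the second tensor factor. -/
def channelExtend {A B : Type} (Φ : Matrix A A ℂ →ₗ[ℂ] Matrix B B ℂ) (R : Type)
    (X : Matrix (A × R) (A × R) ℂ) : Matrix (B × R) (B × R) ℂ :=
  Matrix.of fun x y => Φ (Matrix.of fun a a' => X (a, x.2) (a', y.2)) x.1 y.1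

/-- Quantum channels: completely positive, trace preserving linear maps. -/
def IsQuantumChannel {A B : Type} [Fintype A] [Fintype B]
    (Φ : Matrix A A ℂ →ₗ[ℂ] Matrix B B ℂ) : Prop :=
  (∀ (R : Type) [Fintype R] (X : Matrix (A × R) (A × R) ℂ),
      X.PosSemidef → (channelExtend Φ R X).PosSemidef) ∧
    ∀ X : Matrix A A ℂ, (Φ X).trace = X.trace

/-- The fidelity `F(ρ, σ) = tr √(√ρ σ √ρ)`. -/
def fidelity {A : Type} [Fintype A] [DecidableEq A] (ρ σ : Matrix A A ℂ) : ℝ :=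
  (CFC.sqrt (CFC.sqrt ρ * σ * CFC.sqrt ρ)).trace.re

/-- The density matrix of the maximally entangled state `|A|^{-1/2} ∑ᵢ |i⟩|i⟩`. -/
def maxEntangled (A : Type) [Fintype A] [DecidableEq A] : Matrix (A × A) (A × A) ℂ :=
  Matrix.of fun x y => if x.1 = x.2 ∧ y.1 = y.2 then (Fintype.card A : ℂ)⁻¹ else 0

/-- The single-qubit depolarizing channel `ρ ↦ (1 - p) ρ + p tr(ρ) 𝟙/2` of strength `p`. -/
def depolarizing (p : ℝ) : Matrix (Fin 2) (Fin 2) ℂ →ₗ[ℂ] Matrix (Fin 2) (Fin 2) ℂ :=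
  ((1 - p : ℝ) : ℂ) • LinearMap.id +
    (p : ℂ) • (Matrix.traceLinearMap (Fin 2) ℂ ℂ).smulRight
      ((2 : ℂ)⁻¹ • (1 : Matrix (Fin 2) (Fin 2) ℂ))

/-- The tensor power `⨂_{q ∈ Q} Φ` of a single-qubit map: the linear map with
`|x⟩⟨y| ↦ ⨂_q Φ(|x_q⟩⟨y_q|)`. -/
def tensorPowerMap {Q : Type} [Fintype Q] [DecidableEq Q]
    (Φ : Matrix (Fin 2) (Fin 2) ℂ →ₗ[ℂ] Matrix (Fin 2) (Fin 2) ℂ) :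
    Matrix (Bits Q) (Bits Q) ℂ →ₗ[ℂ] Matrix (Bits Q) (Bits Q) ℂ where
  toFun ρ := Matrix.of fun u v =>
    ∑ x : Bits Q, ∑ y : Bits Q, ρ x y * ∏ q : Q, Φ (Matrix.single (x q) (y q) 1) (u q) (v q)
  map_add' ρ σ := by
    ext u v
    simp [add_mul, Finset.sum_add_distrib]
  map_smul' c ρ := by
    ext u v
    simp [mul_assoc, Finset.mul_sum]

/-! ### Circuits -/

/-- A one- or two-qubit gate: a unitary acting on the qubits in `supp`. -/
structure Gate (Q : Type) [DecidableEq Q] where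
  supp : Finset Q
  card_supp_le : supp.card ≤ 2
  op : Matrix.unitaryGroup (Bits supp) ℂ

/-- The gate acting on the whole register, as the identity outside its support. -/
def Gate.toMatrix {Q : Type} [Fintype Q] [DecidableEq Q] (g : Gate Q) :
    Matrix (Bits Q) (Bits Q) ℂ :=
  Matrix.of fun x y =>
    if ∀ q, q ∉ g.supp → x q = y q then
      (g.op : Matrix (Bits g.supp) (Bits g.supp) ℂ) (fun q => x q) (fun q => y q)
    else 0

/-- A layer of gates with pairwise disjoint supports. -/
structure Layer (Q : Type) [DecidableEq Q] where
  gates : List (Gate Q)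
  disjoint_supp : gates.Pairwise fun g h => Disjoint g.supp h.supp

def Layer.toMatrix {Q : Type} [Fintype Q] [DecidableEq Q] (l : Layer Q) :
    Matrix (Bits Q) (Bits Q) ℂ :=
  (l.gates.map Gate.toMatrix).prod

/-- A depth-`d` unitary encoding of `k` logical qubits into `n` physical qubits: the choice of the
input qubits that carry the logical state (all others are ancillas, initially `|0⟩`), and `d` layers
of gates, applied in increasing order. There is no restriction on which pairs of qubits interact. -/
structure EncodingCircuit (n k d : ℕ) where
  logical : Fin k ↪ Fin n
  layers : Fin d → Layer (Fin n)

namespace EncodingCircuit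

variable {n k d : ℕ}

/-- The unitary `U = U_d ⋯ U_1` of the circuit. -/
def circuitMatrix (C : EncodingCircuit n k d) : Matrix (Bits (Fin n)) (Bits (Fin n)) ℂ :=
  (List.ofFn fun t => (C.layers t).toMatrix).reverse.prod

/-- The isometry `|y⟩_L ↦ |y⟩_L ⊗ |0⟩_{S \ L}`. -/
def ancillaIsometry (C : EncodingCircuit n k d) : Matrix (Bits (Fin n)) (Bits (Fin k)) ℂ :=
  Matrix.of fun x y =>
    if (∀ i, x (C.logical i) = y i) ∧ ∀ q, q ∉ Set.range C.logical → x q = 0 then 1 else 0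

/-- The encoding channel `ρ ↦ U (ρ ⊗ |0⟩⟨0|) U†`. -/
def encode (C : EncodingCircuit n k d) :
    Matrix (Bits (Fin k)) (Bits (Fin k)) ℂ →ₗ[ℂ] Matrix (Bits (Fin n)) (Bits (Fin n)) ℂ where
  toFun ρ :=
    C.circuitMatrix * (C.ancillaIsometry * ρ * C.ancillaIsometryᴴ) * C.circuitMatrixᴴ
  map_add' ρ σ := by simp [Matrix.mul_add, Matrix.add_mul]
  map_smul' c ρ := by simp

/-- The Choi fidelity of the code against the noise `N`: the optimum over all decoding channels of
the fidelity between the maximally entangled state and its recovered version. -/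
def choiFidelity (C : EncodingCircuit n k d)
    (N : Matrix (Bits (Fin n)) (Bits (Fin n)) ℂ →ₗ[ℂ] Matrix (Bits (Fin n)) (Bits (Fin n)) ℂ) : ℝ :=
  ⨆ D : {D : Matrix (Bits (Fin n)) (Bits (Fin n)) ℂ →ₗ[ℂ] Matrix (Bits (Fin k)) (Bits (Fin k)) ℂ //
      IsQuantumChannel D},
    fidelity (maxEntangled (Bits (Fin k)))
      (channelExtend (D.1 ∘ₗ N ∘ₗ C.encode) (Bits (Fin k)) (maxEntangled (Bits (Fin k))))

/-- The Choi error `√(1 - F²)` against i.i.d. depolarizing noise of strength `p` on all physical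
qubits. -/
def choiError (C : EncodingCircuit n k d) (p : ℝ) : ℝ :=
  √(1 - C.choiFidelity (tensorPowerMap (depolarizing p)) ^ 2)

end EncodingCircuit

/-- Nearest neighbours on the `D`-dimensional grid `∏ₐ ℤ/mₐ`. Since `ZMod 0 = ℤ`, a direction with
`m a = 0` is an unbounded line, and one with `m a > 0` is periodic. -/
def GridNeighbors {D : ℕ} (m : Fin D → ℕ) (x y : (a : Fin D) → ZMod (m a)) : Prop :=
  ∃ a : Fin D, y = x + Pi.single a 1 ∨ x = y + Pi.single a 1

/-- `D`-dimensional circuits: the qubits can be placed on distinct sites of a `D`-dimensional grid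
(with open or periodic boundaries) such that two-qubit gates act on nearest neighbours only. -/
def EncodingCircuit.IsDimensional {n k d : ℕ} (C : EncodingCircuit n k d) (D : ℕ) : Prop :=
  ∃ (m : Fin D → ℕ) (pos : Fin n → (a : Fin D) → ZMod (m a)), Function.Injective pos ∧
    ∀ t, ∀ g ∈ (C.layers t).gates, ∀ q ∈ g.supp, ∀ q' ∈ g.supp, q ≠ q' →
      GridNeighbors m (pos q) (pos q')

end

/-! Depolarizing noise of strength `p` is a random erasure: each qubit is independently replaced by
the maximally mixed state with probability `p` (`tensorPowerMap_depolarizing`). If the erased set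
`T` contains every output that a logical qubit can influence, that qubit is lost and no decoder can
restore its entanglement with the reference.

To make this quantitative, let `A` be a set of logical qubits whose light cones lie in `T`. An
operator on `A`, conjugated through the circuit, is supported in `T`, and erasing `T` is cyclic with
respect to such operators. Hence the map Λ given by encoding, erasing `T` and decoding satisfies
Λ(Mρ) = Λ(ρM) for all M on `A` (`eraseMap_encode_mul_comm`). A trace-preserving map with this
property whose Choi state is positive semidefinite has squared Choi fidelity at most 4^(-|A|)
(`entOverlap_le_of_forgetful`).

For logical qubits with pairwise disjoint cones the losses are independent events. Averaging over
`T` bounds the squared fidelity by the product of the factors 1 - (3/4) p^|cone|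
(`choiFidelity_sq_le`). If every forward and backward cone has at most s elements, a maximal
disjoint family contains at least k/s² cones (`exists_pairwiseDisjoint_subfamily`). With a Bernoulli
estimate this gives (3/8) k p^s ≤ ε² s² (`le_choiError_sq`), whose logarithm is the depth bound once
s = (2d)^D (`card_reaches_le_grid`) or s = 2^d (`card_reaches_le_two_pow`) is inserted. -/

set_option linter.unusedSectionVars false

noncomputable section

/-! ### Local operators -/

section LocalOperators

variable {Q : Type} [Fintype Q] [DecidableEq Q]

/-- The operator `W` acts on the qubits in `T` only: it has the form `w ⊗ 1`. -/
def ActsOn (T : Finset Q) (W : Matrix (Bits Q) (Bits Q) ℂ) : Prop :=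
  (∀ x y, W x y ≠ 0 → ∀ q ∉ T, x q = y q) ∧
    ∀ x y x' y', (∀ q ∉ T, x q = y q) → (∀ q ∉ T, x' q = y' q) →
      (∀ q ∈ T, x q = x' q) → (∀ q ∈ T, y q = y' q) → W x y = W x' y'

theorem ActsOn.eq_zero {T : Finset Q} {W : Matrix (Bits Q) (Bits Q) ℂ} (h : ActsOn T W)
    {x y : Bits Q} (hxy : ¬ ∀ q ∉ T, x q = y q) : W x y = 0 := by
  by_contra hne
  exact hxy (h.1 x y hne)

theorem ActsOn.mono {S T : Finset Q} (hST : S ⊆ T) {W : Matrix (Bits Q) (Bits Q) ℂ}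
    (h : ActsOn S W) : ActsOn T W := by
  refine ⟨fun x y hne q hq => h.1 x y hne q fun hS => hq (hST hS), ?_⟩
  intro x y x' y' hxy hxy' hx hy
  by_cases hS : ∀ q ∉ S, x q = y q
  · have hS' : ∀ q ∉ S, x' q = y' q := fun q hq => by
      by_cases hT : q ∈ T
      · rw [← hx q hT, ← hy q hT, hS q hq]
      · exact hxy' q hT
    exact h.2 _ _ _ _ hS hS' (fun q hq => hx q (hST hq)) fun q hq => hy q (hST hq)
  · have hS' : ¬ ∀ q ∉ S, x' q = y' q := fun hS' => hS fun q hq => by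
      by_cases hT : q ∈ T
      · rw [hx q hT, hy q hT, hS' q hq]
      · exact hxy q hT
    rw [h.eq_zero hS, h.eq_zero hS']

theorem ActsOn.mul {T : Finset Q} {W V : Matrix (Bits Q) (Bits Q) ℂ}
    (hW : ActsOn T W) (hV : ActsOn T V) : ActsOn T (W * V) := by
  constructor
  · intro x y hne q hq
    rw [Matrix.mul_apply] at hne
    obtain ⟨z, -, hz⟩ := Finset.exists_ne_zero_of_sum_ne_zero hne
    rw [hW.1 x z (left_ne_zero_of_mul hz) q hq, hV.1 z y (right_ne_zero_of_mul hz) q hq]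
  · intro x y x' y' hxy hxy' hx hy
    have key : ∀ x y : Bits Q, (W * V) x y =
        ∑ z with ∀ q ∉ T, z q = x q, W x z * V z y := by
      intro x y
      rw [Matrix.mul_apply, Finset.sum_filter_of_ne]
      exact fun z _ hz q hq => (hW.1 x z (left_ne_zero_of_mul hz) q hq).symm
    rw [key, key]
    -- An intermediate index is free on `T` and pinned to the row index off `T`, so the two sums
    -- correspond by exchanging the pinned part.
    refine Finset.sum_nbij' (fun z => T.piecewise z x') (fun z => T.piecewise z x) ?_ ?_ ?_ ?_ ?_
    · intro z _
      simp +contextual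
    · intro z _
      simp +contextual
    · intro z hz
      ext1 q
      by_cases hq : q ∈ T <;> simp_all
    · intro z hz
      ext1 q
      by_cases hq : q ∈ T <;> simp_all
    · intro z hz
      simp only [Finset.mem_filter, Finset.mem_univ, true_and] at hz
      congr 1
      · exact hW.2 _ _ _ _ (fun q hq => (hz q hq).symm) (fun q hq => by simp [hq]) hx
          (fun q hq => by simp [hq])
      · exact hV.2 _ _ _ _ (fun q hq => (hz q hq).trans (hxy q hq))
          (fun q hq => by simp [hq, hxy']) (fun q hq => by simp [hq]) hy

theorem ActsOn.conjTranspose {T : Finset Q} {W : Matrix (Bits Q) (Bits Q) ℂ}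
    (hW : ActsOn T W) : ActsOn T Wᴴ := by
  constructor
  · intro x y hne q hq
    rw [Matrix.conjTranspose_apply] at hne
    exact (hW.1 y x (star_ne_zero.mp hne) q hq).symm
  · intro x y x' y' hxy hxy' hx hy
    rw [Matrix.conjTranspose_apply, Matrix.conjTranspose_apply]
    rw [hW.2 y x y' x' (fun q hq => (hxy q hq).symm) (fun q hq => (hxy' q hq).symm) hy hx]

/-- In each order a single intermediate index survives: one factor fixes it off `S`, the other off
`T`, and disjointness makes these conditions determine it everywhere. -/
theorem ActsOn.commute {S T : Finset Q} (hST : Disjoint S T) {W V : Matrix (Bits Q) (Bits Q) ℂ}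
    (hW : ActsOn S W) (hV : ActsOn T V) : W * V = V * W := by
  have hS : ∀ q ∈ S, q ∉ T := fun _ hq => Finset.disjoint_left.mp hST hq
  ext x y
  rw [Matrix.mul_apply, Matrix.mul_apply, Finset.sum_eq_single (S.piecewise y x),
    Finset.sum_eq_single (S.piecewise x y)]
  · by_cases h : ∀ q, q ∉ S → q ∉ T → x q = y q
    · rw [mul_comm]
      congr 1
      · refine hV.2 _ _ _ _ (fun q hq => ?_) (fun q hq => ?_) (fun q hq => ?_) (fun q hq => ?_)
        · by_cases hqS : q ∈ S <;> simp [hqS, h, hq]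
        · by_cases hqS : q ∈ S <;> simp [hqS, h, hq]
        · simp [show q ∉ S from fun h => hS q h hq]
        · simp [show q ∉ S from fun h => hS q h hq]
      · refine hW.2 _ _ _ _ (fun q hq => ?_) (fun q hq => ?_) (fun q hq => ?_) (fun q hq => ?_) <;>
          simp [hq]
    · push Not at h
      obtain ⟨q, hqS, hqT, hq⟩ := h
      rw [hV.eq_zero (x := S.piecewise y x), hV.eq_zero (y := S.piecewise x y)]
      · simp
      · exact fun h => hq (by simpa [hqS] using h q hqT)
      · exact fun h => hq (by simpa [hqS] using h q hqT)
  · intro z _ hz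
    by_contra hne
    refine hz (funext fun q => ?_)
    by_cases hq : q ∈ S
    · simpa [hq] using (hV.1 x z (left_ne_zero_of_mul hne) q (hS q hq)).symm
    · simpa [hq] using hW.1 z y (right_ne_zero_of_mul hne) q hq
  · simp
  · intro z _ hz
    by_contra hne
    refine hz (funext fun q => ?_)
    by_cases hq : q ∈ S
    · simpa [hq] using hV.1 z y (right_ne_zero_of_mul hne) q (hS q hq)
    · simpa [hq] using (hW.1 x z (left_ne_zero_of_mul hne) q hq).symm
  · simp

theorem Gate.actsOn (g : Gate Q) : ActsOn g.supp g.toMatrix := by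
  constructor
  · intro x y hne
    by_contra h
    exact hne (if_neg h)
  · intro x y x' y' hxy hxy' hx hy
    simp only [Gate.toMatrix, Matrix.of_apply]
    rw [if_pos hxy, if_pos hxy']
    rw [show (fun q : g.supp => x q) = fun q : g.supp => x' q from funext fun q => hx q q.2,
      show (fun q : g.supp => y q) = fun q : g.supp => y' q from funext fun q => hy q q.2]

open scoped Kronecker in
theorem Gate.toMatrix_eq_submatrix (g : Gate Q) :
    g.toMatrix = ((g.op : Matrix (Bits g.supp) (Bits g.supp) ℂ) ⊗ₖ
      (1 : Matrix ({q // q ∉ g.supp} → Fin 2) ({q // q ∉ g.supp} → Fin 2) ℂ)).submatrix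
      (Equiv.piEquivPiSubtypeProd (· ∈ g.supp) fun _ => Fin 2)
      (Equiv.piEquivPiSubtypeProd (· ∈ g.supp) fun _ => Fin 2) := by
  ext x y
  simp only [Gate.toMatrix, Matrix.of_apply, Matrix.submatrix_apply, Matrix.kroneckerMap_apply,
    Matrix.one_apply, Equiv.piEquivPiSubtypeProd_apply, mul_ite, mul_one, mul_zero, funext_iff,
    Subtype.forall]

open scoped Kronecker in
theorem Gate.mul_conjTranspose (g : Gate Q) : g.toMatrix * g.toMatrixᴴ = 1 := by
  have hop : (g.op : Matrix (Bits g.supp) (Bits g.supp) ℂ) *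
      (g.op : Matrix (Bits g.supp) (Bits g.supp) ℂ)ᴴ = 1 := Matrix.mem_unitaryGroup_iff.mp g.op.2
  rw [g.toMatrix_eq_submatrix, Matrix.conjTranspose_submatrix, Matrix.submatrix_mul_equiv,
    Matrix.conjTranspose_kronecker, ← Matrix.mul_kronecker_mul, hop, Matrix.conjTranspose_one,
    mul_one, Matrix.one_kronecker_one, Matrix.submatrix_one_equiv]

theorem Layer.mul_conjTranspose (l : Layer Q) : l.toMatrix * l.toMatrixᴴ = 1 := by
  obtain ⟨gs, hgs⟩ := l
  simp only [Layer.toMatrix]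
  clear hgs
  induction gs with
  | nil => simp
  | cons g gs ih =>
    rw [List.map_cons, List.prod_cons, Matrix.conjTranspose_mul, Matrix.mul_assoc,
      ← Matrix.mul_assoc _ _ g.toMatrixᴴ, ih, Matrix.one_mul, g.mul_conjTranspose]

/-! ### Light cones -/

/-- The qubits `q`, `q'` are equal or joined by a gate. -/
def GatesLink (gs : List (Gate Q)) (q q' : Q) : Prop :=
  q = q' ∨ ∃ g ∈ gs, q ∈ g.supp ∧ q' ∈ g.supp

theorem GatesLink.symm {gs : List (Gate Q)} {q q' : Q} (h : GatesLink gs q q') :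
    GatesLink gs q' q := by
  rcases h with rfl | ⟨g, hg, h, h'⟩
  · exact Or.inl rfl
  · exact Or.inr ⟨g, hg, h', h⟩

/-- There is a path in the circuit with the layers `ls` from the input `q` to the output `q'`. -/
def Reaches : List (Layer Q) → Q → Q → Prop
  | [], q, q' => q = q'
  | l :: ls, q, q' => ∃ m, GatesLink l.gates q m ∧ Reaches ls m q'

theorem Reaches.refl (ls : List (Layer Q)) (q : Q) : Reaches ls q q := by
  induction ls with
  | nil => rfl
  | cons l ls ih => exact ⟨q, Or.inl rfl, ih⟩

theorem Reaches.concat {ls : List (Layer Q)} {l : Layer Q} {q m q' : Q} (h : Reaches ls q m)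
    (h' : GatesLink l.gates m q') : Reaches (ls ++ [l]) q q' := by
  induction ls generalizing q with
  | nil =>
    obtain rfl : q = m := h
    exact ⟨q', h', rfl⟩
  | cons l₁ ls ih =>
    obtain ⟨r, hr, hrm⟩ := h
    exact ⟨r, hr, ih hrm⟩

theorem Reaches.reverse {ls : List (Layer Q)} {q q' : Q} (h : Reaches ls q q') :
    Reaches ls.reverse q' q := by
  induction ls generalizing q with
  | nil => exact Eq.symm h
  | cons l ls ih =>
    obtain ⟨m, hm, hmq⟩ := h
    rw [List.reverse_cons]
    exact (ih hmq).concat hm.symm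

open Classical in
/-- The outputs that the inputs in `T` can reach. -/
def lightCone (ls : List (Layer Q)) (T : Finset Q) : Finset Q :=
  Finset.univ.filter fun q' => ∃ q ∈ T, Reaches ls q q'

theorem mem_lightCone {ls : List (Layer Q)} {T : Finset Q} {q' : Q} :
    q' ∈ lightCone ls T ↔ ∃ q ∈ T, Reaches ls q q' := by
  classical
  simp [lightCone]

-- One layer in the Heisenberg picture: gates that miss `T` cancel against their adjoints, and only
-- gates that meet `T` enlarge the support.
open Classical in
theorem ActsOn.conj_gates {T : Finset Q} {W : Matrix (Bits Q) (Bits Q) ℂ} (hW : ActsOn T W)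
    {gs : List (Gate Q)} (hgs : gs.Pairwise fun g h => Disjoint g.supp h.supp) :
    ActsOn (Finset.univ.filter fun q' => ∃ q ∈ T, GatesLink gs q q')
      ((gs.map Gate.toMatrix).prod * W * (gs.map Gate.toMatrix).prodᴴ) := by
  induction gs with
  | nil => simpa [GatesLink] using hW
  | cons g gs ih =>
    rw [List.pairwise_cons] at hgs
    specialize ih hgs.2
    set S : Finset Q := Finset.univ.filter fun q' => ∃ q ∈ T, GatesLink gs q q' with hS
    set U : Finset Q := Finset.univ.filter fun q' => ∃ q ∈ T, GatesLink (g :: gs) q q' with hU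
    have hSU : S ⊆ U := by
      intro q' hq'
      rw [hS, Finset.mem_filter] at hq'
      rw [hU, Finset.mem_filter]
      obtain ⟨-, q, hq, h⟩ := hq'
      refine ⟨Finset.mem_univ _, q, hq, ?_⟩
      rcases h with h | ⟨g', hg', h⟩
      · exact Or.inl h
      · exact Or.inr ⟨g', List.mem_cons_of_mem _ hg', h⟩
    have hprod : ((g :: gs).map Gate.toMatrix).prod * W * ((g :: gs).map Gate.toMatrix).prodᴴ =
        g.toMatrix * ((gs.map Gate.toMatrix).prod * W * (gs.map Gate.toMatrix).prodᴴ) *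
          g.toMatrixᴴ := by
      simp only [List.map_cons, List.prod_cons, Matrix.conjTranspose_mul, Matrix.mul_assoc]
    rw [hprod]
    -- A gate missing `T` also misses the support already enlarged by the other gates, because
    -- supports within a layer are disjoint. It therefore commutes past the operator and cancels.
    by_cases hd : Disjoint g.supp T
    · have hdS : Disjoint g.supp S := by
        rw [Finset.disjoint_left] at hd ⊢
        intro q' hq' hS'
        rw [hS, Finset.mem_filter] at hS'
        obtain ⟨-, q, hq, h⟩ := hS'
        rcases h with rfl | ⟨g', hg', -, h⟩
        · exact hd hq' hq
        · exact Finset.disjoint_left.mp (hgs.1 g' hg') hq' h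
      rw [g.actsOn.commute hdS ih, Matrix.mul_assoc, g.mul_conjTranspose, Matrix.mul_one]
      exact ih.mono hSU
    · have hg : ActsOn U g.toMatrix := by
        refine g.actsOn.mono fun q' hq' => ?_
        obtain ⟨q, hq, hqT⟩ := Finset.not_disjoint_iff.mp hd
        rw [hU, Finset.mem_filter]
        exact ⟨Finset.mem_univ _, q, hqT, Or.inr ⟨g, List.mem_cons_self, hq, hq'⟩⟩
      exact (hg.mul (ih.mono hSU)).mul hg.conjTranspose

/-- The unitary of the circuit with the layers `ls`, the first of which is applied first. -/
def layersMatrix (ls : List (Layer Q)) : Matrix (Bits Q) (Bits Q) ℂ :=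
  (ls.map Layer.toMatrix).reverse.prod

theorem layersMatrix_cons (l : Layer Q) (ls : List (Layer Q)) :
    layersMatrix (l :: ls) = layersMatrix ls * l.toMatrix := by
  simp [layersMatrix]

theorem layersMatrix_mul_conjTranspose (ls : List (Layer Q)) :
    layersMatrix ls * (layersMatrix ls)ᴴ = 1 := by
  induction ls with
  | nil => simp [layersMatrix]
  | cons l ls ih =>
    rw [layersMatrix_cons, Matrix.conjTranspose_mul, Matrix.mul_assoc,
      ← Matrix.mul_assoc l.toMatrix, l.mul_conjTranspose, Matrix.one_mul, ih]

theorem layersMatrix_conjTranspose_mul (ls : List (Layer Q)) :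
    (layersMatrix ls)ᴴ * layersMatrix ls = 1 :=
  mul_eq_one_comm.mp (layersMatrix_mul_conjTranspose ls)

theorem ActsOn.conj_layers {T : Finset Q} {W : Matrix (Bits Q) (Bits Q) ℂ} (hW : ActsOn T W)
    (ls : List (Layer Q)) :
    ActsOn (lightCone ls T) (layersMatrix ls * W * (layersMatrix ls)ᴴ) := by
  classical
  induction ls generalizing T W with
  | nil => simpa [layersMatrix, lightCone, Reaches] using hW
  | cons l ls ih =>
    have h := ih (hW.conj_gates l.disjoint_supp)
    have hprod : layersMatrix (l :: ls) * W * (layersMatrix (l :: ls))ᴴ =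
        layersMatrix ls * (l.toMatrix * W * l.toMatrixᴴ) * (layersMatrix ls)ᴴ := by
      simp only [layersMatrix_cons, Matrix.conjTranspose_mul, Matrix.mul_assoc]
    rw [hprod]
    refine h.mono fun q' hq' => ?_
    obtain ⟨m, hmT, hm⟩ := mem_lightCone.mp hq'
    obtain ⟨-, q, hq, hqm⟩ := Finset.mem_filter.mp hmT
    exact mem_lightCone.mpr ⟨q, hq, m, hqm, hm⟩

end LocalOperators


/-! ### Erasure of a set of qubits -/

section Erasure

variable {Q : Type} [Fintype Q] [DecidableEq Q]

/-- The coefficient of `|u⟩⟨v|` in the image of `|x⟩⟨y|` under complete depolarization of the qubits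
in `T`. -/
def eraseKernel (T : Finset Q) (x y u v : Bits Q) : ℂ :=
  ∏ q, if q ∈ T then (if x q = y q ∧ u q = v q then 2⁻¹ else 0)
    else if x q = u q ∧ y q = v q then 1 else 0

/-- Complete depolarization of the qubits in `T`. -/
def eraseMap (T : Finset Q) : Matrix (Bits Q) (Bits Q) ℂ →ₗ[ℂ] Matrix (Bits Q) (Bits Q) ℂ where
  toFun ρ := Matrix.of fun u v => ∑ x, ∑ y, ρ x y * eraseKernel T x y u v
  map_add' ρ σ := by
    ext u v
    simp [add_mul, Finset.sum_add_distrib]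
  map_smul' c ρ := by
    ext u v
    simp [mul_assoc, Finset.mul_sum]

theorem eraseMap_apply (T : Finset Q) (ρ : Matrix (Bits Q) (Bits Q) ℂ) (u v : Bits Q) :
    eraseMap T ρ u v = ∑ x, ∑ y, ρ x y * eraseKernel T x y u v := rfl

theorem eraseKernel_eq (T : Finset Q) (x y u v : Bits Q) :
    eraseKernel T x y u v =
      if (∀ q ∈ T, x q = y q ∧ u q = v q) ∧ ∀ q ∉ T, x q = u q ∧ y q = v q
      then 2⁻¹ ^ T.card else 0 := by
  rw [eraseKernel]
  split_ifs with h
  · have : ∀ q, (if q ∈ T then (if x q = y q ∧ u q = v q then (2⁻¹ : ℂ) else 0)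
        else if x q = u q ∧ y q = v q then 1 else 0) = if q ∈ T then 2⁻¹ else 1 := by
      intro q
      by_cases hq : q ∈ T
      · simp [hq, h.1 q hq]
      · simp [hq, h.2 q hq]
    simp [this]
  · rw [Finset.prod_eq_zero_iff]
    by_contra! hne
    refine h ⟨fun q hq => ?_, fun q hq => ?_⟩
    · have := hne q (Finset.mem_univ q)
      by_contra hc
      simp [hq, hc] at this
    · have := hne q (Finset.mem_univ q)
      by_contra hc
      simp [hq, hc] at this

theorem sum_mul_eraseKernel {T : Finset Q} {W : Matrix (Bits Q) (Bits Q) ℂ} (hW : ActsOn T W)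
    (y z u v : Bits Q) :
    ∑ x, W x z * eraseKernel T x y u v = ∑ x, W y x * eraseKernel T z x u v := by
  rw [Finset.sum_eq_single (T.piecewise y z), Finset.sum_eq_single (T.piecewise z y)]
  · congr 1
    · exact hW.2 _ _ _ _ (fun q hq => by simp [hq]) (fun q hq => by simp [hq])
        (fun q hq => by simp [hq]) (fun q hq => by simp [hq])
    · rw [eraseKernel_eq, eraseKernel_eq]
      congr 1
      simp +contextual
  · intro x _ hx
    by_contra hne
    have hK := right_ne_zero_of_mul hne
    rw [eraseKernel_eq, ite_ne_right_iff] at hK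
    refine hx (funext fun q => ?_)
    by_cases hq : q ∈ T
    · simp [hq, hK.1.1 q hq]
    · simp [hq, hW.1 y x (left_ne_zero_of_mul hne) q hq]
  · simp
  · intro x _ hx
    by_contra hne
    have hK := right_ne_zero_of_mul hne
    rw [eraseKernel_eq, ite_ne_right_iff] at hK
    refine hx (funext fun q => ?_)
    by_cases hq : q ∈ T
    · simp [hq, hK.1.1 q hq]
    · simp [hq, hW.1 x z (left_ne_zero_of_mul hne) q hq]
  · simp

/-- Erasure traces out `T`, and a partial trace over `T` is cyclic for operators living on `T`. The
entrywise form is `sum_mul_eraseKernel`. -/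
theorem eraseMap_mul_comm {T : Finset Q} {W : Matrix (Bits Q) (Bits Q) ℂ} (hW : ActsOn T W)
    (X : Matrix (Bits Q) (Bits Q) ℂ) : eraseMap T (W * X) = eraseMap T (X * W) := by
  ext u v
  have hL : eraseMap T (W * X) u v = ∑ z, ∑ y, X z y * ∑ x, W x z * eraseKernel T x y u v := by
    simp only [eraseMap_apply, Matrix.mul_apply, Finset.sum_mul, Finset.mul_sum]
    refine Finset.sum_comm.trans (Eq.trans ?_ Finset.sum_comm)
    refine Finset.sum_congr rfl fun y _ => ?_
    rw [Finset.sum_comm]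
    exact Finset.sum_congr rfl fun z _ => Finset.sum_congr rfl fun x _ => by ring
  have hR : eraseMap T (X * W) u v = ∑ z, ∑ y, X z y * ∑ x, W y x * eraseKernel T z x u v := by
    simp only [eraseMap_apply, Matrix.mul_apply, Finset.sum_mul, Finset.mul_sum]
    refine Finset.sum_congr rfl fun z _ => ?_
    rw [Finset.sum_comm]
    exact Finset.sum_congr rfl fun y _ => Finset.sum_congr rfl fun x _ => by ring
  rw [hL, hR]
  simp only [sum_mul_eraseKernel hW]

/-! ### Complete positivity -/

open scoped Kronecker in
theorem posSemidef_channelExtend_of_kraus {A B J R : Type} [Fintype A] [Fintype B] [Fintype J]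
    [Fintype R] {Φ : Matrix A A ℂ →ₗ[ℂ] Matrix B B ℂ} (K : J → Matrix B A ℂ)
    (hΦ : ∀ ρ, Φ ρ = ∑ j, K j * ρ * (K j)ᴴ) {X : Matrix (A × R) (A × R) ℂ} (hX : X.PosSemidef) :
    (channelExtend Φ R X).PosSemidef := by
  classical
  have h : channelExtend Φ R X =
      ∑ j, (K j ⊗ₖ (1 : Matrix R R ℂ)) * X * (K j ⊗ₖ (1 : Matrix R R ℂ))ᴴ := by
    ext ⟨b, r⟩ ⟨b', r'⟩
    simp only [channelExtend, Matrix.of_apply, hΦ, Matrix.sum_apply]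
    refine Finset.sum_congr rfl fun j _ => ?_
    simp [Matrix.mul_apply, Fintype.sum_prod_type, Matrix.one_apply, apply_ite]
  rw [h]
  exact Matrix.posSemidef_sum _ fun j _ => hX.mul_mul_conjTranspose_same _

theorem posSemidef_channelExtend_eraseMap (T : Finset Q) {R : Type} [Fintype R]
    {X : Matrix (Bits Q × R) (Bits Q × R) ℂ} (hX : X.PosSemidef) :
    (channelExtend (eraseMap T) R X).PosSemidef := by
  -- Single-qubit Kraus operators: the four matrix units divided by √2 on `T`, and the identity
  -- padded by three zeros off `T`, so that all qubits share one index type.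
  let κ (q : Q) (j : Fin 2 × Fin 2) (a b : Fin 2) : ℂ :=
    if q ∈ T then (if a = j.1 ∧ b = j.2 then (√2 : ℝ)⁻¹ else 0)
    else if j = 0 ∧ a = b then 1 else 0
  have hsqrt : ((√2 : ℝ) : ℂ)⁻¹ * ((√2 : ℝ) : ℂ)⁻¹ = 2⁻¹ := by
    rw [← mul_inv, ← Complex.ofReal_mul, Real.mul_self_sqrt zero_le_two]
    simp
  have hκ : ∀ q a b c d, ∑ j, κ q j c a * star (κ q j d b) =
      if q ∈ T then (if a = b ∧ c = d then 2⁻¹ else 0) else if a = c ∧ b = d then 1 else 0 := by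
    intro q a b c d
    by_cases hq : q ∈ T
    · simp only [κ, hq, if_true, Fintype.sum_prod_type, Fin.sum_univ_two]
      fin_cases a <;> fin_cases b <;> fin_cases c <;> fin_cases d <;> simp [hsqrt]
    · simp only [κ, hq, if_false, Fintype.sum_prod_type, Fin.sum_univ_two]
      fin_cases a <;> fin_cases b <;> fin_cases c <;> fin_cases d <;> simp
  refine posSemidef_channelExtend_of_kraus
    (fun j : Q → Fin 2 × Fin 2 => Matrix.of fun u x => ∏ q, κ q (j q) (u q) (x q)) ?_ hX
  intro ρ
  ext u v
  rw [eraseMap_apply, Matrix.sum_apply]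
  have hK : ∀ x y, eraseKernel T x y u v =
      ∑ j : Q → Fin 2 × Fin 2,
        (∏ q, κ q (j q) (u q) (x q)) * star (∏ q, κ q (j q) (v q) (y q)) := by
    intro x y
    simp only [eraseKernel, ← hκ, Finset.prod_univ_sum, Fintype.piFinset_univ, star_prod,
      Finset.prod_mul_distrib]
  simp only [hK, Finset.mul_sum, Matrix.mul_apply, Matrix.conjTranspose_apply, Matrix.of_apply,
    Finset.sum_mul]
  rw [Finset.sum_comm, Finset.sum_comm (γ := Q → Fin 2 × Fin 2)]
  refine Finset.sum_congr rfl fun y _ => ?_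
  rw [Finset.sum_comm]
  exact Finset.sum_congr rfl fun j _ => Finset.sum_congr rfl fun x _ => by ring

theorem trace_eraseMap (T : Finset Q) (ρ : Matrix (Bits Q) (Bits Q) ℂ) :
    (eraseMap T ρ).trace = ρ.trace := by
  have hK : ∀ x y, ∑ u, eraseKernel T x y u u = if x = y then 1 else 0 := by
    intro x y
    simp only [eraseKernel, and_true]
    rw [← Fintype.piFinset_univ, ← Finset.prod_univ_sum (fun _ : Q => (Finset.univ : Finset (Fin 2)))
      (fun q a => if q ∈ T then (if x q = y q then (2⁻¹ : ℂ) else 0)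
        else if x q = a ∧ y q = a then 1 else 0)]
    have : ∀ q, ∑ a, (if q ∈ T then (if x q = y q then (2⁻¹ : ℂ) else 0)
        else if x q = a ∧ y q = a then 1 else 0) = if x q = y q then 1 else 0 := by
      intro q
      rw [Fin.sum_univ_two]
      generalize x q = a
      generalize y q = b
      by_cases hq : q ∈ T <;> fin_cases a <;> fin_cases b <;> norm_num [hq]
    simp only [this, Finset.prod_ite_zero, Finset.mem_univ, true_imp_iff, funext_iff,
      Finset.prod_const_one]
  simp only [Matrix.trace, Matrix.diag_apply, eraseMap_apply]
  rw [Finset.sum_comm]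
  refine Finset.sum_congr rfl fun x _ => ?_
  rw [Finset.sum_comm]
  simp [← Finset.mul_sum, hK]

/-! ### Depolarizing noise as a random erasure -/

/-- The single-qubit channel is `p` times erasure plus `1 - p` times the identity; multiplying out
the tensor power gives one term for each set of erased qubits. -/
theorem tensorPowerMap_depolarizing (p : ℝ) (ρ : Matrix (Bits Q) (Bits Q) ℂ) :
    tensorPowerMap (depolarizing p) ρ =
      ∑ T : Finset Q, ((p ^ T.card * (1 - p) ^ (Finset.univ \ T).card : ℝ) : ℂ) •
        eraseMap T ρ := by
  ext u v
  have hdep : ∀ a b c d : Fin 2, depolarizing p (Matrix.single a b 1) c d =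
      p * (if a = b ∧ c = d then 2⁻¹ else 0) + (1 - p) * if a = c ∧ b = d then 1 else 0 := by
    intro a b c d
    fin_cases a <;> fin_cases b <;> fin_cases c <;> fin_cases d <;>
      simp [depolarizing] <;> ring
  have hprod : ∀ x y : Bits Q, ∏ q, depolarizing p (Matrix.single (x q) (y q) 1) (u q) (v q) =
      ∑ T : Finset Q, ((p ^ T.card * (1 - p) ^ (Finset.univ \ T).card : ℝ) : ℂ) *
        eraseKernel T x y u v := by
    intro x y
    simp only [hdep]
    rw [Finset.prod_add, Finset.powerset_univ]
    refine Finset.sum_congr rfl fun T _ => ?_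
    rw [Finset.prod_mul_distrib, Finset.prod_mul_distrib, Finset.prod_const, Finset.prod_const,
      eraseKernel, ← Finset.prod_sdiff (Finset.subset_univ T)]
    rw [Finset.prod_congr (s₁ := T) rfl fun q hq => if_pos hq,
      Finset.prod_congr (s₁ := Finset.univ \ T) rfl fun q hq => if_neg (Finset.mem_sdiff.mp hq).2]
    push_cast
    ring
  simp only [tensorPowerMap, LinearMap.coe_mk, AddHom.coe_mk, Matrix.of_apply, hprod,
    Matrix.sum_apply, Matrix.smul_apply, eraseMap_apply, smul_eq_mul, Finset.mul_sum]
  rw [Finset.sum_comm (γ := Finset Q)]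
  refine Finset.sum_congr rfl fun x _ => ?_
  rw [Finset.sum_comm]
  exact Finset.sum_congr rfl fun T _ => Finset.sum_congr rfl fun y _ => by ring

end Erasure


/-! ### The fidelity with the maximally entangled state -/

section Fidelity

variable {A : Type} [Fintype A] [DecidableEq A]

/-- The overlap `⟨φ|σ|φ⟩` with the maximally entangled state `φ`. -/
def entOverlap (σ : Matrix (A × A) (A × A) ℂ) : ℝ :=
  (Fintype.card A : ℝ)⁻¹ * ∑ a, ∑ b, (σ (a, a) (b, b)).re

theorem maxEntangled_mul_self [Nonempty A] : maxEntangled A * maxEntangled A = maxEntangled A := by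
  ext ⟨a, a'⟩ ⟨b, b'⟩
  have hN : (Fintype.card A : ℂ) ≠ 0 := Nat.cast_ne_zero.mpr Fintype.card_ne_zero
  by_cases h : a = a' <;> by_cases h' : b = b' <;>
    simp [maxEntangled, Matrix.mul_apply, Fintype.sum_prod_type, h, h', hN]

theorem maxEntangled_posSemidef [Nonempty A] : (maxEntangled A).PosSemidef := by
  have h : (maxEntangled A)ᴴ = maxEntangled A := by
    ext x y
    simp only [maxEntangled, Matrix.conjTranspose_apply, Matrix.of_apply, and_comm]
    split_ifs <;> simp
  have := Matrix.posSemidef_conjTranspose_mul_self (maxEntangled A)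
  rwa [h, maxEntangled_mul_self] at this

theorem trace_maxEntangled [Nonempty A] : (maxEntangled A).trace = 1 := by
  simp [maxEntangled, Matrix.trace, Fintype.sum_prod_type]

theorem maxEntangled_mul_mul (σ : Matrix (A × A) (A × A) ℂ) :
    maxEntangled A * σ * maxEntangled A =
      ((Fintype.card A : ℂ)⁻¹ * ∑ a, ∑ b, σ (a, a) (b, b)) • maxEntangled A := by
  ext ⟨a, a'⟩ ⟨b, b'⟩
  by_cases h : a = a' <;> by_cases h' : b = b' <;>
    simp [maxEntangled, Matrix.mul_apply, Fintype.sum_prod_type, h, h']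
  rw [← Finset.sum_mul, Finset.sum_comm]
  simp only [← Finset.mul_sum]

theorem fidelity_nonneg (ρ σ : Matrix A A ℂ) : 0 ≤ fidelity ρ σ :=
  (Complex.le_def.mp (Matrix.nonneg_iff_posSemidef.mp (CFC.sqrt_nonneg _)).trace_nonneg).1

/-- The maximally entangled state φ is a rank-one projector, so √φ = φ and φσφ = cφ with c the
overlap. The fidelity is then the trace of √c φ. -/
theorem fidelity_maxEntangled_sq [Nonempty A] {σ : Matrix (A × A) (A × A) ℂ}
    (hσ : σ.PosSemidef) : fidelity (maxEntangled A) σ ^ 2 = entOverlap σ := by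
  set c : ℂ := (Fintype.card A : ℂ)⁻¹ * ∑ a, ∑ b, σ (a, a) (b, b) with hc
  have hφ : (0 : Matrix (A × A) (A × A) ℂ) ≤ maxEntangled A :=
    Matrix.nonneg_iff_posSemidef.mpr maxEntangled_posSemidef
  have hsqrt : CFC.sqrt (maxEntangled A) = maxEntangled A :=
    CFC.sqrt_unique maxEntangled_mul_self hφ
  have hc0 : 0 ≤ c := by
    have h := (hσ.mul_mul_conjTranspose_same (maxEntangled A)).trace_nonneg
    rwa [maxEntangled_posSemidef.1, maxEntangled_mul_mul, Matrix.trace_smul, trace_maxEntangled,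
      smul_eq_mul, mul_one] at h
  have hre : c.re = entOverlap σ := by
    rw [hc, entOverlap, ← Complex.ofReal_natCast, ← Complex.ofReal_inv, Complex.re_ofReal_mul]
    simp
  have hr0 : 0 ≤ c.re := (Complex.le_def.mp hc0).1
  have hcr : c = (c.re : ℂ) := Complex.ext rfl (by simpa using (Complex.le_def.mp hc0).2.symm)
  have hs : CFC.sqrt (maxEntangled A * σ * maxEntangled A) = ((√c.re : ℝ) : ℂ) • maxEntangled A := by
    refine CFC.sqrt_unique ?_ ?_
    · rw [Matrix.smul_mul, Matrix.mul_smul, smul_smul, maxEntangled_mul_self,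
        ← Complex.ofReal_mul, Real.mul_self_sqrt hr0, maxEntangled_mul_mul, ← hcr]
    · rw [Matrix.nonneg_iff_posSemidef]
      exact maxEntangled_posSemidef.smul (by simp)
  rw [fidelity, hsqrt, hs, Matrix.trace_smul, trace_maxEntangled, smul_eq_mul, mul_one,
    Complex.ofReal_re, Real.sq_sqrt hr0, hre]

end Fidelity

/-- Positivity of the quadratic form at the difference of two basis vectors. -/
theorem Matrix.PosSemidef.two_mul_re_le {ι : Type} [Fintype ι] [DecidableEq ι] {σ : Matrix ι ι ℂ}
    (hσ : σ.PosSemidef) (i j : ι) : 2 * (σ i j).re ≤ (σ i i).re + (σ j j).re := by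
  have h := (Complex.le_def.mp (hσ.dotProduct_mulVec_nonneg (Pi.single i 1 - Pi.single j 1))).1
  have hij : (σ j i).re = (σ i j).re := by
    rw [← hσ.1.apply i j]
    simp
  simp [Matrix.mulVec_sub, sub_dotProduct, dotProduct_sub] at h
  linarith

/-! ### Channels that forget some of the qubits -/

section Forgetful

variable {Q : Type} [Fintype Q] [DecidableEq Q]

theorem card_filter_eq_on (A : Finset Q) (a : Bits Q) :
    (Finset.univ.filter fun b : Bits Q => ∀ q ∈ A, b q = a q).card * 2 ^ A.card =
      2 ^ Fintype.card Q := by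
  have h : (Finset.univ.filter fun b : Bits Q => ∀ q ∈ A, b q = a q) =
      Fintype.piFinset fun q => if q ∈ A then {a q} else Finset.univ := by
    ext b
    simp only [Finset.mem_filter, Finset.mem_univ, true_and, Fintype.mem_piFinset]
    refine forall_congr' fun q => ?_
    by_cases hq : q ∈ A <;> simp [hq]
  have hcard : ∀ q, (if q ∈ A then {a q} else (Finset.univ : Finset (Fin 2))).card =
      if q ∈ A then 1 else 2 := by
    intro q
    by_cases hq : q ∈ A <;> simp [hq]
  rw [h, Fintype.card_piFinset]
  simp only [hcard]
  have hA : 2 ^ A.card = ∏ q, if q ∈ A then 2 else 1 := by simp [Finset.prod_ite_mem]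
  rw [hA, ← Finset.prod_mul_distrib, Finset.prod_congr rfl (g := fun _ => 2) fun q _ => by
    by_cases hq : q ∈ A <;> simp [hq]]
  simp

/-- Apply the cyclicity hypothesis to M = |t⟩⟨r| on `A` tensored with the identity. This yields both
facts needed about the Choi state: entries whose indices disagree on `A` vanish, and the others do
not change when the `A`-part of the reference is shifted. -/
theorem apply_single_piecewise {B : Type} {A : Finset Q}
    {Λ : Matrix (Bits Q) (Bits Q) ℂ →ₗ[ℂ] Matrix B B ℂ}
    (hΛ : ∀ M, ActsOn A M → ∀ ρ, Λ (M * ρ) = Λ (ρ * M)) (t r y : Bits Q) :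
    Λ (Matrix.single (A.piecewise t r) y 1) =
      if ∀ q ∈ A, y q = t q then Λ (Matrix.single r (A.piecewise r y) 1) else 0 := by
  let M : Matrix (Bits Q) (Bits Q) ℂ := Matrix.of fun x y =>
    if (∀ q ∉ A, x q = y q) ∧ ∀ q ∈ A, x q = t q ∧ y q = r q then 1 else 0
  have hM : ActsOn A M := by
    constructor
    · intro x y hne
      simp only [M, Matrix.of_apply, ne_eq, ite_eq_right_iff, Classical.not_imp] at hne
      exact hne.1.1
    · intro x y x' y' hxy hxy' hx hy
      simp only [M, Matrix.of_apply]
      congr 1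
      simp +contextual [hxy, hxy', hx, hy]
  have h₁ : M * Matrix.single r y 1 = Matrix.single (A.piecewise t r) y 1 := by
    ext a b
    by_cases hb : y = b
    · subst hb
      simp only [Matrix.mul_single_apply_same, mul_one, Matrix.single_apply, M, Matrix.of_apply,
        and_true]
      congr 1
      rw [eq_iff_iff, funext_iff]
      refine ⟨fun h q => ?_, fun h => ⟨fun q hq => ?_, fun q hq => ?_⟩⟩
      · by_cases hq : q ∈ A <;> simp [hq, h]
      · simpa [hq] using (h q).symm
      · simpa [hq] using (h q).symm
    · rw [Matrix.mul_single_apply_of_ne _ _ _ _ _ (Ne.symm hb)]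
      simp [hb]
  have h₂ : Matrix.single r y 1 * M =
      if ∀ q ∈ A, y q = t q then Matrix.single r (A.piecewise r y) 1 else 0 := by
    ext a b
    by_cases ha : a = r
    · subst ha
      rw [Matrix.single_mul_apply_same, one_mul]
      have hb : (Matrix.single a (A.piecewise a y) 1 : Matrix (Bits Q) (Bits Q) ℂ) a b =
          if (∀ q ∉ A, y q = b q) ∧ ∀ q ∈ A, b q = a q then 1 else 0 := by
        simp only [Matrix.single_apply, true_and]
        congr 1
        rw [eq_iff_iff, funext_iff]
        refine ⟨fun h => ⟨fun q hq => ?_, fun q hq => ?_⟩, fun h q => ?_⟩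
        · simpa [hq] using h q
        · simpa [hq] using (h q).symm
        · by_cases hq : q ∈ A <;> simp [hq, h]
      simp only [M, Matrix.of_apply]
      split_ifs with h h' h'
      · rw [hb, if_pos ⟨h.1, fun q hq => (h.2 q hq).2⟩]
      · exact absurd (fun q hq => (h.2 q hq).1) h'
      · rw [hb, if_neg fun hc => h ⟨hc.1, fun q hq => ⟨h' q hq, hc.2 q hq⟩⟩]
      · rfl
    · rw [Matrix.single_mul_apply_of_ne _ _ _ _ _ ha]
      split_ifs
      · simp [Ne.symm ha]
      · rfl
  rw [← h₁, hΛ M hM, h₂]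
  split_ifs <;> simp

theorem channelExtend_maxEntangled_apply {A B : Type} [Fintype A] [DecidableEq A]
    (Λ : Matrix A A ℂ →ₗ[ℂ] Matrix B B ℂ) (b b' : B) (r r' : A) :
    channelExtend Λ A (maxEntangled A) (b, r) (b', r') =
      (Fintype.card A : ℂ)⁻¹ * Λ (Matrix.single r r' 1) b b' := by
  have h : (Matrix.of fun a a' => maxEntangled A (a, r) (a', r')) =
      (Fintype.card A : ℂ)⁻¹ • Matrix.single r r' 1 := by
    ext a a'
    simp [maxEntangled, Matrix.single_apply, eq_comm]
  simp only [channelExtend, Matrix.of_apply, h, map_smul, Matrix.smul_apply, smul_eq_mul]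

/-- With N = 2^|Q| and m = N/2^|A|, each row of the overlap sum has only m possibly nonzero entries.
Each of them can be averaged over all shifts of the reference on `A`, and positivity bounds it by
diagonal entries. The shifted diagonals share the total trace 1, so the overlap is at most m²/N² =
4^(-|A|). -/
theorem entOverlap_le_of_forgetful {A : Finset Q}
    {Λ : Matrix (Bits Q) (Bits Q) ℂ →ₗ[ℂ] Matrix (Bits Q) (Bits Q) ℂ}
    (hΛ : ∀ M, ActsOn A M → ∀ ρ, Λ (M * ρ) = Λ (ρ * M))
    (hpos : (channelExtend Λ (Bits Q) (maxEntangled (Bits Q))).PosSemidef)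
    (htr : ∀ ρ, (Λ ρ).trace = ρ.trace) :
    entOverlap (channelExtend Λ (Bits Q) (maxEntangled (Bits Q))) ≤ 4⁻¹ ^ A.card := by
  set σ := channelExtend Λ (Bits Q) (maxEntangled (Bits Q)) with hσ
  have hσΛ : ∀ b r b' r', σ (b, r) (b', r') =
      (Fintype.card (Bits Q) : ℂ)⁻¹ * Λ (Matrix.single r r' 1) b b' :=
    fun b r b' r' => channelExtend_maxEntangled_apply Λ b b' r r'
  let N : ℝ := 2 ^ Fintype.card Q
  have hN : (Fintype.card (Bits Q) : ℝ) = N := by simp [N]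
  have hN0 : 0 < N := by positivity
  have hzero : ∀ a b : Bits Q, (¬ ∀ q ∈ A, b q = a q) → σ (a, a) (b, b) = 0 := by
    intro a b hab
    have h := apply_single_piecewise hΛ a a b
    rw [if_neg hab, Finset.piecewise_same] at h
    simp [hσΛ, h]
  have hshift : ∀ a b t : Bits Q, (∀ q ∈ A, b q = a q) →
      σ (a, A.piecewise t a) (b, A.piecewise t b) = σ (a, a) (b, b) := by
    intro a b t hab
    have h := apply_single_piecewise hΛ t a (A.piecewise t b)
    rw [if_pos (by simp +contextual)] at h
    have hb : A.piecewise a (A.piecewise t b) = b := by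
      ext1 q
      by_cases hq : q ∈ A <;> simp [hq, hab]
    rw [hb] at h
    rw [hσΛ, hσΛ, h]
  let m : ℝ := N / 2 ^ A.card
  have hm : ∀ a : Bits Q, ((Finset.univ.filter fun b : Bits Q => ∀ q ∈ A, b q = a q).card : ℝ) = m := by
    intro a
    rw [eq_div_iff (by positivity)]
    simp only [N]
    exact_mod_cast card_filter_eq_on A a
  have hdiag : ∀ i, 0 ≤ (σ i i).re := fun i => (Complex.le_def.mp hpos.diag_nonneg).1
  have htrσ : ∑ a, ∑ r, (σ (a, r) (a, r)).re = 1 := by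
    rw [Finset.sum_comm]
    have h : ∀ r, ∑ a, (σ (a, r) (a, r)).re = N⁻¹ := by
      intro r
      have h1 : ∑ a, Λ (Matrix.single r r 1) a a = 1 := by
        have h2 := htr (Matrix.single r r 1)
        rwa [Matrix.trace_single_eq_same] at h2
      simp only [hσΛ]
      rw [← Complex.re_sum, ← Finset.mul_sum, h1, mul_one, ← Complex.ofReal_natCast,
        ← Complex.ofReal_inv, Complex.ofReal_re, hN]
    simp only [h]
    simp [N]
  -- A pair (a, r) is produced only by those `t` that agree with `r` on `A`, so each diagonal entry
  -- is counted at most m times.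
  have hcount : ∑ a, ∑ t, (σ (a, A.piecewise t a) (a, A.piecewise t a)).re ≤ m := by
    have h : ∀ a, ∑ t, (σ (a, A.piecewise t a) (a, A.piecewise t a)).re ≤
        m * ∑ r, (σ (a, r) (a, r)).re := by
      intro a
      rw [← Finset.sum_fiberwise (s := Finset.univ) (g := fun t => A.piecewise t a), Finset.mul_sum]
      refine Finset.sum_le_sum fun r _ => ?_
      rw [Finset.sum_congr rfl (g := fun _ => (σ (a, r) (a, r)).re) fun t ht => by
        rw [(Finset.mem_filter.mp ht).2], Finset.sum_const, nsmul_eq_mul, ← hm r]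
      refine mul_le_mul_of_nonneg_right ?_ (hdiag _)
      refine Nat.cast_le.mpr (Finset.card_le_card fun t ht => ?_)
      simp only [Finset.mem_filter, Finset.mem_univ, true_and] at ht ⊢
      intro q hq
      simp [← ht, hq]
    calc _ ≤ ∑ a, m * ∑ r, (σ (a, r) (a, r)).re := Finset.sum_le_sum fun a _ => h a
      _ = m := by rw [← Finset.mul_sum, htrσ, mul_one]
  have hsum : N * ∑ a, ∑ b, (σ (a, a) (b, b)).re ≤ m * m := by
    -- The factor N is spent on a sum over all strings `t`, of which only the restriction to `A`
    -- matters; shift invariance makes every summand equal.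
    have h1 : N * ∑ a, ∑ b, (σ (a, a) (b, b)).re =
        ∑ t : Bits Q, ∑ a, ∑ b with ∀ q ∈ A, b q = a q,
          (σ (a, A.piecewise t a) (b, A.piecewise t b)).re := by
      rw [← hN, ← Finset.card_univ, ← nsmul_eq_mul, ← Finset.sum_const]
      refine Finset.sum_congr rfl fun t _ => ?_
      refine Finset.sum_congr rfl fun a _ => ?_
      rw [Finset.sum_filter]
      refine Finset.sum_congr rfl fun b _ => ?_
      split_ifs with hab
      · rw [hshift a b t hab]
      · rw [hzero a b hab, Complex.zero_re]
    have h2 : ∀ t a b : Bits Q, (σ (a, A.piecewise t a) (b, A.piecewise t b)).re ≤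
        2⁻¹ * (σ (a, A.piecewise t a) (a, A.piecewise t a)).re +
          2⁻¹ * (σ (b, A.piecewise t b) (b, A.piecewise t b)).re := fun t a b => by
      linarith [hpos.two_mul_re_le (a, A.piecewise t a) (b, A.piecewise t b)]
    have h3 : ∀ t : Bits Q, ∑ a, ∑ b with ∀ q ∈ A, b q = a q,
        (σ (a, A.piecewise t a) (b, A.piecewise t b)).re ≤
          m * ∑ a, (σ (a, A.piecewise t a) (a, A.piecewise t a)).re := by
      intro t
      calc _ ≤ ∑ a, ∑ b with ∀ q ∈ A, b q = a q,
            (2⁻¹ * (σ (a, A.piecewise t a) (a, A.piecewise t a)).re +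
              2⁻¹ * (σ (b, A.piecewise t b) (b, A.piecewise t b)).re) :=
            Finset.sum_le_sum fun a _ => Finset.sum_le_sum fun b _ => h2 t a b
        _ = m * ∑ a, (σ (a, A.piecewise t a) (a, A.piecewise t a)).re := by
            simp only [Finset.sum_add_distrib, Finset.sum_const, nsmul_eq_mul, hm]
            rw [Finset.sum_comm' (s := Finset.univ)
              (t := fun a : Bits Q => Finset.univ.filter fun b : Bits Q => ∀ q ∈ A, b q = a q)
              (t' := Finset.univ)
              (s' := fun b : Bits Q => Finset.univ.filter fun a : Bits Q => ∀ q ∈ A, a q = b q)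
              (by simp [eq_comm])]
            simp only [Finset.sum_const, nsmul_eq_mul, hm, ← Finset.mul_sum]
            ring
    rw [h1]
    calc _ ≤ ∑ t : Bits Q, m * ∑ a, (σ (a, A.piecewise t a) (a, A.piecewise t a)).re :=
          Finset.sum_le_sum fun t _ => h3 t
      _ = m * ∑ a, ∑ t, (σ (a, A.piecewise t a) (a, A.piecewise t a)).re := by
          rw [← Finset.mul_sum, Finset.sum_comm]
      _ ≤ m * m := mul_le_mul_of_nonneg_left hcount (by positivity)
  have hmm : m * m = N * N * 4⁻¹ ^ A.card := by
    rw [inv_pow, show (4 : ℝ) = 2 * 2 by norm_num, mul_pow]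
    simp only [m]
    field_simp
  rw [entOverlap, hN, inv_mul_le_iff₀ hN0]
  refine le_of_mul_le_mul_left ?_ hN0
  linarith

end Forgetful


/-! ### Erasing the light cone of logical qubits -/

section Lift

variable {n k : ℕ}

/-- The operator on the physical register that acts as `M` on the logical input qubits in `A`. -/
def liftOp (l : Fin k ↪ Fin n) (A : Finset (Fin k)) (M : Matrix (Bits (Fin k)) (Bits (Fin k)) ℂ) :
    Matrix (Bits (Fin n)) (Bits (Fin n)) ℂ :=
  Matrix.of fun x y => if ∀ q ∉ A.map l, x q = y q then M (x ∘ l) (y ∘ l) else 0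

theorem ActsOn.liftOp {A : Finset (Fin k)} {M : Matrix (Bits (Fin k)) (Bits (Fin k)) ℂ}
    (hM : ActsOn A M) (l : Fin k ↪ Fin n) : ActsOn (A.map l) (liftOp l A M) := by
  constructor
  · intro x y hne
    by_contra h
    exact hne (if_neg h)
  · intro x y x' y' hxy hxy' hx hy
    simp only [_root_.liftOp, Matrix.of_apply]
    rw [if_pos hxy, if_pos hxy']
    refine hM.2 _ _ _ _ (fun i hi => ?_) (fun i hi => ?_) (fun i hi => ?_) (fun i hi => ?_)
    · exact hxy _ (by simpa using hi)
    · exact hxy' _ (by simpa using hi)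
    · exact hx _ (by simpa using hi)
    · exact hy _ (by simpa using hi)

theorem conjTranspose_liftOp (l : Fin k ↪ Fin n) (A : Finset (Fin k))
    (M : Matrix (Bits (Fin k)) (Bits (Fin k)) ℂ) : (liftOp l A M)ᴴ = liftOp l A Mᴴ := by
  ext x y
  simp only [liftOp, Matrix.conjTranspose_apply, Matrix.of_apply, eq_comm (a := x _)]
  split_ifs <;> simp

end Lift

namespace EncodingCircuit

variable {n k d : ℕ} (C : EncodingCircuit n k d)

theorem ancillaIsometry_apply (x : Bits (Fin n)) (y : Bits (Fin k)) :
    C.ancillaIsometry x y = if x = Function.extend C.logical y 0 then 1 else 0 := by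
  simp only [ancillaIsometry, Matrix.of_apply]
  congr 1
  rw [eq_iff_iff]
  constructor
  · rintro ⟨h, h0⟩
    ext1 q
    by_cases hq : q ∈ Set.range C.logical
    · obtain ⟨i, rfl⟩ := hq
      rw [C.logical.injective.extend_apply, h]
    · rw [Function.extend_apply' _ _ _ hq, h0 q hq, Pi.zero_apply]
  · rintro rfl
    exact ⟨fun i => C.logical.injective.extend_apply _ _ _,
      fun q hq => Function.extend_apply' _ _ _ hq⟩

theorem ancillaIsometry_isometry : C.ancillaIsometryᴴ * C.ancillaIsometry = 1 := by
  ext y y'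
  simp only [Matrix.mul_apply, Matrix.conjTranspose_apply, ancillaIsometry_apply, Matrix.one_apply]
  rw [Finset.sum_eq_single (Function.extend C.logical y 0)]
  · have hinj : Function.extend C.logical y 0 = Function.extend C.logical y' 0 ↔ y = y' := by
      refine ⟨fun h => funext fun i => ?_, fun h => by rw [h]⟩
      simpa [C.logical.injective.extend_apply] using congrFun h (C.logical i)
    simp [hinj]
  · intro x _ hx
    simp [hx]
  · simp

/-- The lifted operator is the identity on the ancillas, so it keeps them at zero and acts on the
embedded logical qubits as the original operator does. -/
theorem ancillaIsometry_mul {A : Finset (Fin k)} {M : Matrix (Bits (Fin k)) (Bits (Fin k)) ℂ}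
    (hM : ActsOn A M) : C.ancillaIsometry * M = liftOp C.logical A M * C.ancillaIsometry := by
  ext x y
  have hR : (liftOp C.logical A M * C.ancillaIsometry) x y =
      liftOp C.logical A M x (Function.extend C.logical y 0) := by
    simp [Matrix.mul_apply, ancillaIsometry_apply]
  have hcomp : Function.extend C.logical y 0 ∘ C.logical = y :=
    funext fun i => C.logical.injective.extend_apply _ _ _
  rw [hR, Matrix.mul_apply]
  simp only [liftOp, Matrix.of_apply, hcomp]
  by_cases h0 : ∀ q ∉ Set.range C.logical, x q = 0
  · rw [Finset.sum_eq_single (x ∘ C.logical)]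
    · have h1 : C.ancillaIsometry x (x ∘ C.logical) = 1 := if_pos ⟨fun _ => rfl, h0⟩
      rw [h1, one_mul]
      split_ifs with h
      · rfl
      · refine hM.eq_zero fun hc => h fun q hq => ?_
        by_cases hq' : q ∈ Set.range C.logical
        · obtain ⟨i, rfl⟩ := hq'
          rw [C.logical.injective.extend_apply]
          exact hc i (by simpa using hq)
        · rw [Function.extend_apply' _ _ _ hq', h0 q hq', Pi.zero_apply]
    · intro z _ hz
      have : C.ancillaIsometry x z = 0 := if_neg fun h => hz (funext fun i => (h.1 i).symm)
      rw [this, zero_mul]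
    · simp
  · rw [if_neg, Finset.sum_eq_zero]
    · intro z _
      have : C.ancillaIsometry x z = 0 := if_neg fun h => h0 h.2
      rw [this, zero_mul]
    · intro hc
      push Not at h0
      obtain ⟨q, hq, hx⟩ := h0
      refine hx ?_
      rw [hc q, Function.extend_apply' _ _ _ hq, Pi.zero_apply]
      intro hqA
      obtain ⟨i, -, rfl⟩ := Finset.mem_map.mp hqA
      exact hq ⟨i, rfl⟩

theorem mul_ancillaIsometry_conjTranspose {A : Finset (Fin k)}
    {M : Matrix (Bits (Fin k)) (Bits (Fin k)) ℂ} (hM : ActsOn A M) :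
    M * C.ancillaIsometryᴴ = C.ancillaIsometryᴴ * liftOp C.logical A M := by
  have h := congrArg Matrix.conjTranspose (C.ancillaIsometry_mul hM.conjTranspose)
  rwa [Matrix.conjTranspose_mul, Matrix.conjTranspose_mul, conjTranspose_liftOp,
    Matrix.conjTranspose_conjTranspose] at h

/-- The layers of the circuit, in the order in which they are applied. -/
def layerList : List (Layer (Fin n)) := List.ofFn C.layers

theorem circuitMatrix_eq : C.circuitMatrix = layersMatrix C.layerList := by
  rw [circuitMatrix, layersMatrix, layerList, List.map_ofFn]
  rfl

theorem encode_apply (ρ : Matrix (Bits (Fin k)) (Bits (Fin k)) ℂ) : C.encode ρ =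
    C.circuitMatrix * (C.ancillaIsometry * ρ * C.ancillaIsometryᴴ) * C.circuitMatrixᴴ := rfl

theorem trace_encode (ρ : Matrix (Bits (Fin k)) (Bits (Fin k)) ℂ) :
    (C.encode ρ).trace = ρ.trace := by
  rw [encode_apply, Matrix.trace_mul_comm, ← Matrix.mul_assoc, circuitMatrix_eq,
    layersMatrix_conjTranspose_mul, Matrix.one_mul, Matrix.trace_mul_comm, ← Matrix.mul_assoc,
    ancillaIsometry_isometry, Matrix.one_mul]

theorem posSemidef_channelExtend_encode {R : Type} [Fintype R]
    {X : Matrix (Bits (Fin k) × R) (Bits (Fin k) × R) ℂ} (hX : X.PosSemidef) :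
    (channelExtend C.encode R X).PosSemidef := by
  refine posSemidef_channelExtend_of_kraus (fun _ : Unit => C.circuitMatrix * C.ancillaIsometry)
    (fun ρ => ?_) hX
  simp only [encode_apply, Finset.univ_unique, Finset.sum_const, Finset.card_singleton, one_smul,
    Matrix.conjTranspose_mul, Matrix.mul_assoc]

/-- Left or right multiplication by M before encoding becomes multiplication on the same side by U
M' U† afterwards, where M' is the lift of M. That operator lives in the light cone, hence in `T`,
where `eraseMap_mul_comm` applies. -/
theorem eraseMap_encode_mul_comm {A : Finset (Fin k)} {T : Finset (Fin n)}
    (hT : lightCone C.layerList (A.map C.logical) ⊆ T)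
    {M : Matrix (Bits (Fin k)) (Bits (Fin k)) ℂ} (hM : ActsOn A M)
    (ρ : Matrix (Bits (Fin k)) (Bits (Fin k)) ℂ) :
    eraseMap T (C.encode (M * ρ)) = eraseMap T (C.encode (ρ * M)) := by
  set U := layersMatrix C.layerList with hU
  set M' := liftOp C.logical A M
  have hUU : Uᴴ * U = 1 := layersMatrix_conjTranspose_mul _
  have hW : ActsOn T (U * M' * Uᴴ) := ((hM.liftOp C.logical).conj_layers C.layerList).mono hT
  have h1 : C.encode (M * ρ) = (U * M' * Uᴴ) * C.encode ρ := by
    rw [encode_apply, encode_apply, circuitMatrix_eq, ← hU]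
    calc U * (C.ancillaIsometry * (M * ρ) * C.ancillaIsometryᴴ) * Uᴴ = U * (C.ancillaIsometry * M) * ρ * C.ancillaIsometryᴴ * Uᴴ := by
          simp only [Matrix.mul_assoc]
      -- The inserted `1` marks the place where U†U is put in.
      _ = U * (M' * 1 * C.ancillaIsometry) * ρ * C.ancillaIsometryᴴ * Uᴴ := by
          rw [C.ancillaIsometry_mul hM, Matrix.mul_one]
      _ = _ := by rw [← hUU]; simp only [Matrix.mul_assoc]
  have h2 : C.encode (ρ * M) = C.encode ρ * (U * M' * Uᴴ) := by
    rw [encode_apply, encode_apply, circuitMatrix_eq, ← hU]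
    calc U * (C.ancillaIsometry * (ρ * M) * C.ancillaIsometryᴴ) * Uᴴ = U * C.ancillaIsometry * ρ * (M * C.ancillaIsometryᴴ) * Uᴴ := by
          simp only [Matrix.mul_assoc]
      _ = U * C.ancillaIsometry * ρ * (C.ancillaIsometryᴴ * ((1 : Matrix (Bits (Fin n)) (Bits (Fin n)) ℂ) * M')) * Uᴴ := by
          rw [C.mul_ancillaIsometry_conjTranspose hM, Matrix.one_mul]
      _ = _ := by rw [← hUU]; simp only [Matrix.mul_assoc]
  rw [h1, h2, eraseMap_mul_comm hW]

/-- The set of outputs that depend on the `i`-th logical qubit. -/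
def cone (i : Fin k) : Finset (Fin n) := lightCone C.layerList {C.logical i}

theorem mem_cone {i : Fin k} {q : Fin n} :
    q ∈ C.cone i ↔ Reaches C.layerList (C.logical i) q := by
  simp [cone, mem_lightCone]

theorem lightCone_subset {A : Finset (Fin k)} {T : Finset (Fin n)} (h : ∀ i ∈ A, C.cone i ⊆ T) :
    lightCone C.layerList (A.map C.logical) ⊆ T := by
  intro q hq
  obtain ⟨q₀, hq₀, hr⟩ := mem_lightCone.mp hq
  obtain ⟨i, hi, rfl⟩ := Finset.mem_map.mp hq₀
  exact h i hi (C.mem_cone.mpr hr)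

theorem entOverlap_eraseMap_le {D : Matrix (Bits (Fin n)) (Bits (Fin n)) ℂ →ₗ[ℂ]
      Matrix (Bits (Fin k)) (Bits (Fin k)) ℂ} (hD : IsQuantumChannel D)
    {A : Finset (Fin k)} {T : Finset (Fin n)} (h : ∀ i ∈ A, C.cone i ⊆ T) :
    (channelExtend (D ∘ₗ eraseMap T ∘ₗ C.encode) (Bits (Fin k))
      (maxEntangled (Bits (Fin k)))).PosSemidef ∧
    entOverlap (channelExtend (D ∘ₗ eraseMap T ∘ₗ C.encode) (Bits (Fin k))
      (maxEntangled (Bits (Fin k)))) ≤ 4⁻¹ ^ A.card := by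
  have hpos : (channelExtend (D ∘ₗ eraseMap T ∘ₗ C.encode) (Bits (Fin k))
      (maxEntangled (Bits (Fin k)))).PosSemidef :=
    hD.1 _ _ (posSemidef_channelExtend_eraseMap T
      (C.posSemidef_channelExtend_encode maxEntangled_posSemidef))
  refine ⟨hpos, entOverlap_le_of_forgetful (fun M hM ρ => ?_) hpos fun ρ => ?_⟩
  · simp only [LinearMap.comp_apply]
    rw [C.eraseMap_encode_mul_comm (C.lightCone_subset h) hM]
  · simp only [LinearMap.comp_apply]
    rw [hD.2, trace_eraseMap, trace_encode]

end EncodingCircuit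

/-! ### Averaging over the erased set -/

section Averaging

variable {Q : Type} [Fintype Q] [DecidableEq Q]

/-- The probability that `T` is the set of erased qubits. -/
def eraseWeight (p : ℝ) (T : Finset Q) : ℝ := p ^ T.card * (1 - p) ^ (Finset.univ \ T).card

theorem sum_eraseWeight_superset (p : ℝ) (S : Finset Q) :
    ∑ T : Finset Q, eraseWeight p T * (if S ⊆ T then 1 else 0) = p ^ S.card := by
  -- Giving weight zero to "not erased" on `S` kills exactly the terms of the expansion in which `T`
  -- fails to contain `S`.
  have h := Finset.prod_add (fun _ : Q => p) (fun q => if q ∈ S then 0 else 1 - p) Finset.univ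
  have hL : ∏ q, (p + if q ∈ S then 0 else 1 - p) = p ^ S.card := by
    rw [← Finset.prod_const, ← Finset.univ_inter S, ← Finset.prod_ite_mem, Finset.univ_inter]
    refine Finset.prod_congr rfl fun q _ => ?_
    split_ifs <;> ring
  rw [← hL, h, Finset.powerset_univ]
  refine Finset.sum_congr rfl fun T _ => ?_
  rw [eraseWeight, Finset.prod_const, mul_assoc]
  congr 1
  split_ifs with hST
  · rw [mul_one, ← Finset.prod_const]
    refine Finset.prod_congr rfl fun q hq => (if_neg fun hS => ?_).symm
    exact (Finset.mem_sdiff.mp hq).2 (hST hS)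
  · obtain ⟨q, hq, hqT⟩ := Finset.not_subset.mp hST
    rw [mul_zero, eq_comm]
    exact Finset.prod_eq_zero (i := q) (by simp [hqT]) (if_pos hq)

/-- Independence of the events `S i ⊆ T` for disjoint `S i`. After expanding the product, a
subfamily contributes the probability that its union is erased, and cardinalities add over a
disjoint union. -/
theorem sum_eraseWeight_mul_prod {ι : Type} [DecidableEq ι] (p c : ℝ) (I : Finset ι)
    (S : ι → Finset Q) (hS : (I : Set ι).PairwiseDisjoint S) :
    ∑ T : Finset Q, eraseWeight p T * ∏ i ∈ I, (1 + c * if S i ⊆ T then 1 else 0) =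
      ∏ i ∈ I, (1 + c * p ^ (S i).card) := by
  simp only [Finset.prod_one_add, Finset.mul_sum, Finset.prod_mul_distrib, Finset.prod_const]
  rw [Finset.sum_comm]
  refine Finset.sum_congr rfl fun J hJ => ?_
  have hJ' : (J : Set ι).PairwiseDisjoint S := hS.subset (by simpa using hJ)
  rw [Finset.prod_pow_eq_pow_sum, ← Finset.card_biUnion hJ', ← sum_eraseWeight_superset p,
    Finset.mul_sum]
  refine Finset.sum_congr rfl fun T _ => ?_
  rw [Finset.prod_ite_zero]
  simp only [Finset.biUnion_subset, Finset.prod_const_one]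
  ring

end Averaging

namespace EncodingCircuit

variable {n k d : ℕ} (C : EncodingCircuit n k d)

theorem channelExtend_noise {p : ℝ} (D : Matrix (Bits (Fin n)) (Bits (Fin n)) ℂ →ₗ[ℂ]
      Matrix (Bits (Fin k)) (Bits (Fin k)) ℂ) :
    channelExtend (D ∘ₗ tensorPowerMap (depolarizing p) ∘ₗ C.encode) (Bits (Fin k))
        (maxEntangled (Bits (Fin k))) =
      ∑ T : Finset (Fin n), ((eraseWeight p T : ℝ) : ℂ) •
        channelExtend (D ∘ₗ eraseMap T ∘ₗ C.encode) (Bits (Fin k))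
          (maxEntangled (Bits (Fin k))) := by
  ext x y
  simp only [channelExtend, Matrix.of_apply, LinearMap.comp_apply, tensorPowerMap_depolarizing,
    map_sum, map_smul, Matrix.sum_apply, Matrix.smul_apply, eraseWeight]

/-- With the maximally entangled state as one argument, the squared fidelity is linear in the other,
so it can be averaged over the erased set and each term bounded separately, uniformly in the
decoder. -/
theorem choiFidelity_sq_le {p : ℝ} (hp0 : 0 ≤ p) (hp1 : p ≤ 1) {I : Finset (Fin k)}
    (hI : (I : Set (Fin k)).PairwiseDisjoint C.cone) :
    C.choiFidelity (tensorPowerMap (depolarizing p)) ^ 2 ≤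
      ∏ i ∈ I, (1 - 3 / 4 * p ^ (C.cone i).card) := by
  set B := ∏ i ∈ I, (1 - 3 / 4 * p ^ (C.cone i).card) with hB
  have hB0 : 0 ≤ B := Finset.prod_nonneg fun i _ => by
    linarith [pow_le_one₀ (n := (C.cone i).card) hp0 hp1]
  have hw : ∀ T : Finset (Fin n), 0 ≤ eraseWeight p T := fun T =>
    mul_nonneg (pow_nonneg hp0 _) (pow_nonneg (sub_nonneg.mpr hp1) _)
  suffices h : C.choiFidelity (tensorPowerMap (depolarizing p)) ≤ √B by
    rw [← Real.sq_sqrt hB0]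
    exact pow_le_pow_left₀ (Real.iSup_nonneg fun D => fidelity_nonneg _ _) h 2
  refine Real.iSup_le (fun D => ?_) (Real.sqrt_nonneg _)
  obtain ⟨D, hD⟩ := D
  refine Real.le_sqrt_of_sq_le ?_
  have hpos : (channelExtend (D ∘ₗ tensorPowerMap (depolarizing p) ∘ₗ C.encode) (Bits (Fin k))
      (maxEntangled (Bits (Fin k)))).PosSemidef := by
    rw [C.channelExtend_noise]
    exact Matrix.posSemidef_sum _ fun T _ =>
      (C.entOverlap_eraseMap_le hD (A := ∅) (by simp)).1.smul (by simpa using hw T)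
  rw [fidelity_maxEntangled_sq hpos, C.channelExtend_noise]
  have hlin : ∀ σ : Finset (Fin n) → Matrix (Bits (Fin k) × Bits (Fin k))
      (Bits (Fin k) × Bits (Fin k)) ℂ,
      entOverlap (∑ T, ((eraseWeight p T : ℝ) : ℂ) • σ T) =
        ∑ T, eraseWeight p T * entOverlap (σ T) := by
    intro σ
    simp only [entOverlap, Matrix.sum_apply, Matrix.smul_apply, Complex.re_sum, smul_eq_mul,
      Complex.re_ofReal_mul, mul_left_comm (eraseWeight p _), ← Finset.mul_sum]
    congr 1
    rw [Finset.sum_congr rfl fun a _ => Finset.sum_comm, Finset.sum_comm]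
    simp only [Finset.mul_sum]
  rw [hlin]
  calc _ ≤ ∑ T, eraseWeight p T * ∏ i ∈ I, (1 + (-(3 / 4)) * if C.cone i ⊆ T then 1 else 0) := by
        refine Finset.sum_le_sum fun T _ => mul_le_mul_of_nonneg_left ?_ (hw T)
        -- For fixed `T`, each member of `I` whose cone is erased contributes 1/4 = 1 - 3/4 and
        -- every other member contributes 1.
        refine (C.entOverlap_eraseMap_le hD (A := I.filter fun i => C.cone i ⊆ T)
          fun i hi => (Finset.mem_filter.mp hi).2).2.trans (le_of_eq ?_)
        rw [← Finset.prod_const, Finset.prod_filter]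
        refine Finset.prod_congr rfl fun i _ => ?_
        split_ifs <;> norm_num
    _ = B := by
        rw [sum_eraseWeight_mul_prod p _ I _ hI, hB]
        exact Finset.prod_congr rfl fun i _ => by ring

end EncodingCircuit


/-! ### Sizes of light cones -/

section ConeSize

variable {Q : Type} [Fintype Q] [DecidableEq Q]

/-- Gates in a layer are disjoint and have at most two qubits, so a qubit has at most one partner;
`r = q` covers the absence of one. -/
theorem Layer.exists_partner (l : Layer Q) (q : Q) :
    ∃ r, (r = q ∨ ∃ g ∈ l.gates, q ∈ g.supp ∧ r ∈ g.supp) ∧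
      ∀ m, GatesLink l.gates q m → m = q ∨ m = r := by
  by_cases h : ∃ g ∈ l.gates, q ∈ g.supp
  · obtain ⟨g, hg, hq⟩ := h
    have hcard : (g.supp.erase q).card ≤ 1 := by
      have := g.card_supp_le
      rw [Finset.card_erase_of_mem hq]
      omega
    have huniq : ∀ g' ∈ l.gates, q ∈ g'.supp → g' = g := by
      intro g' hg' hq'
      by_contra hne
      have : Std.Symm fun g h : Gate Q => Disjoint g.supp h.supp := ⟨fun _ _ h => Disjoint.symm h⟩
      exact Finset.disjoint_left.mp (l.disjoint_supp.forall hg' hg hne) hq' hq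
    have hlink : ∀ m, GatesLink l.gates q m → m = q ∨ m ∈ g.supp.erase q := by
      rintro m (rfl | ⟨g', hg', hq', hm⟩)
      · exact Or.inl rfl
      · by_cases hmq : m = q
        · exact Or.inl hmq
        · exact Or.inr (Finset.mem_erase.mpr ⟨hmq, huniq g' hg' hq' ▸ hm⟩)
    rcases (g.supp.erase q).eq_empty_or_nonempty with he | ⟨r, hr⟩
    · exact ⟨q, Or.inl rfl, fun m hm => by simpa [he] using hlink m hm⟩
    · refine ⟨r, Or.inr ⟨g, hg, hq, Finset.mem_of_mem_erase hr⟩, fun m hm => ?_⟩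
      exact (hlink m hm).imp_right fun hm => Finset.card_le_one.mp hcard m hm r hr
  · refine ⟨q, Or.inl rfl, ?_⟩
    rintro m (rfl | ⟨g, hg, hq, -⟩)
    · exact Or.inl rfl
    · exact absurd ⟨g, hg, hq⟩ h

open Classical in
theorem card_reaches_le_two_pow (ls : List (Layer Q)) (q : Q) :
    (Finset.univ.filter fun q' => Reaches ls q q').card ≤ 2 ^ ls.length := by
  induction ls generalizing q with
  | nil =>
    rw [List.length_nil, pow_zero, Finset.card_le_one]
    exact fun a ha b hb => (Finset.mem_filter.mp ha).2.symm.trans (Finset.mem_filter.mp hb).2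
  | cons l ls ih =>
    obtain ⟨r, -, hr⟩ := l.exists_partner q
    have hsub : (Finset.univ.filter fun q' => Reaches (l :: ls) q q') ⊆
        (Finset.univ.filter fun q' => Reaches ls q q') ∪
          Finset.univ.filter fun q' => Reaches ls r q' := by
      intro q' hq'
      obtain ⟨m, hm, hmq⟩ := (Finset.mem_filter.mp hq').2
      rcases hr m hm with rfl | rfl
      · exact Finset.mem_union_left _ (by simpa using hmq)
      · exact Finset.mem_union_right _ (by simpa using hmq)
    calc _ ≤ 2 ^ ls.length + 2 ^ ls.length :=
          (Finset.card_le_card hsub).trans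
            ((Finset.card_union_le _ _).trans (add_le_add (ih q) (ih r)))
      _ = 2 ^ (l :: ls).length := by rw [List.length_cons, pow_succ]; ring

variable {D : ℕ} {m : Fin D → ℕ} {pos : Q → (a : Fin D) → ZMod (m a)}

/-- All two-qubit gates in the layers `ls` act on nearest neighbours. -/
def NearestNeighborLayers (pos : Q → (a : Fin D) → ZMod (m a)) (ls : List (Layer Q)) : Prop :=
  ∀ l ∈ ls, ∀ g ∈ l.gates, ∀ q ∈ g.supp, ∀ q' ∈ g.supp, q ≠ q' →
    GridNeighbors m (pos q) (pos q')

theorem Reaches.exists_shift {ls : List (Layer Q)} (hls : NearestNeighborLayers pos ls) {q q' : Q}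
    (h : Reaches ls q q') : ∃ v : Fin D → ℤ, (∀ a, |v a| ≤ ls.length) ∧
      pos q' = fun a => pos q a + (v a : ZMod (m a)) := by
  induction ls generalizing q with
  | nil =>
    obtain rfl : q = q' := h
    exact ⟨0, by simp, by simp⟩
  | cons l ls ih =>
    obtain ⟨r, hr, hrq⟩ := h
    obtain ⟨v, hv, hpos⟩ := ih (fun l' hl' => hls l' (List.mem_cons_of_mem _ hl')) hrq
    suffices hw : ∃ w : Fin D → ℤ, (∀ a, |w a| ≤ 1) ∧
        pos r = fun a => pos q a + (w a : ZMod (m a)) by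
      obtain ⟨w, hw, hposw⟩ := hw
      refine ⟨w + v, fun a => ?_, ?_⟩
      · rw [List.length_cons]
        push_cast
        exact (abs_add_le _ _).trans (by linarith [hw a, hv a])
      · rw [hpos, hposw]
        ext a
        simp [add_assoc]
    by_cases hqr : q = r
    · subst hqr
      exact ⟨0, by simp, by simp⟩
    rcases hr with h | ⟨g, hg, hq, hr⟩
    · exact absurd h hqr
    obtain ⟨a, ha | ha⟩ := hls l List.mem_cons_self g hg q hq r hr hqr
    · refine ⟨Pi.single a 1, fun b => ?_, ?_⟩
      · by_cases hb : b = a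
        · subst hb; simp
        · simp [hb]
      · rw [ha]
        ext b
        by_cases hb : b = a
        · subst hb; simp
        · simp [hb]
    · refine ⟨Pi.single a (-1), fun b => ?_, ?_⟩
      · by_cases hb : b = a
        · subst hb; simp
        · simp [hb]
      · rw [ha]
        ext b
        by_cases hb : b = a
        · subst hb; simp
        · simp [hb]

-- The side length is `2 * d` rather than `2 * d + 1` because the first layer can only lead from `q`
-- to one neighbour. That pair fits in a box of side 2, and each of the other d - 1 layers adds one
-- site at either end. Integer displacements reduced modulo `m a` treat open and periodic directions
-- alike.
open Classical in
theorem card_reaches_le_grid {ls : List (Layer Q)} (hpos : Function.Injective pos)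
    (hls : NearestNeighborLayers pos ls) (hne : ls ≠ []) (q : Q) :
    (Finset.univ.filter fun q' => Reaches ls q q').card ≤ (2 * ls.length) ^ D := by
  obtain _ | ⟨l, ls⟩ := ls
  · exact absurd rfl hne
  obtain ⟨r, hr, hpartner⟩ := l.exists_partner q
  obtain ⟨b, hb⟩ : ∃ b : (a : Fin D) → ZMod (m a), ∀ q' ∈ ({q, r} : Set Q),
      ∃ w : Fin D → ℤ, (∀ a, 0 ≤ w a ∧ w a ≤ 1) ∧
        pos q' = fun a => b a + (w a : ZMod (m a)) := by
    have hself : ∀ q', ∃ w : Fin D → ℤ, (∀ a, 0 ≤ w a ∧ w a ≤ 1) ∧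
        pos q' = fun a => pos q' a + (w a : ZMod (m a)) := fun q' => ⟨0, by simp, by simp⟩
    have hstep : ∀ q₁ q₂ (a : Fin D), pos q₂ = pos q₁ + Pi.single a 1 →
        ∃ w : Fin D → ℤ, (∀ a, 0 ≤ w a ∧ w a ≤ 1) ∧
          pos q₂ = fun a => pos q₁ a + (w a : ZMod (m a)) := by
      intro q₁ q₂ a h
      refine ⟨Pi.single a 1, fun c => ?_, ?_⟩
      · by_cases hc : c = a
        · subst hc; simp
        · simp [hc]
      · rw [h]
        ext c
        by_cases hc : c = a
        · subst hc; simp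
        · simp [hc]
    by_cases hqr : r = q
    · subst hqr
      refine ⟨pos r, ?_⟩
      rintro q' (rfl | rfl) <;> exact hself _
    obtain ⟨g, hg, hq, hr⟩ := hr.resolve_left hqr
    obtain ⟨a, ha | ha⟩ := hls l List.mem_cons_self g hg q hq r hr (Ne.symm hqr)
    · refine ⟨pos q, ?_⟩
      rintro q' (rfl | rfl)
      · exact hself _
      · exact hstep _ _ a ha
    · refine ⟨pos r, ?_⟩
      rintro q' (rfl | rfl)
      · exact hstep _ _ a ha
      · exact hself _
  have hsub : (Finset.univ.filter fun q' => Reaches (l :: ls) q q').image pos ⊆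
      (Fintype.piFinset fun _ : Fin D => Finset.Icc (-(ls.length : ℤ)) (ls.length + 1)).image
        fun w a => b a + (w a : ZMod (m a)) := by
    intro x hx
    obtain ⟨q', hq', rfl⟩ := Finset.mem_image.mp hx
    obtain ⟨t, ht, htq⟩ := (Finset.mem_filter.mp hq').2
    obtain ⟨w, hw, hposw⟩ := hb t (by simpa using hpartner t ht)
    obtain ⟨v, hv, hposv⟩ := htq.exists_shift fun l' hl' => hls l' (List.mem_cons_of_mem _ hl')
    refine Finset.mem_image.mpr ⟨w + v, ?_, ?_⟩
    · rw [Fintype.mem_piFinset]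
      intro a
      have h1 := hw a
      have h2 := abs_le.mp (hv a)
      rw [Finset.mem_Icc, Pi.add_apply]
      omega
    · rw [hposv, hposw]
      ext a
      simp [add_assoc]
  calc _ = ((Finset.univ.filter fun q' => Reaches (l :: ls) q q').image pos).card :=
        (Finset.card_image_of_injective _ hpos).symm
    _ ≤ _ := (Finset.card_le_card hsub).trans Finset.card_image_le
    _ = _ := by
        rw [Fintype.card_piFinset, Finset.prod_const, Finset.card_univ, Fintype.card_fin,
          Int.card_Icc, List.length_cons]
        congr 1
        omega

end ConeSize

/-- Among finitely many nonempty sets of size at most `s` such that no point is in more than `s` of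
them, at least a fraction `1 / s ^ 2` are pairwise disjoint. -/
theorem exists_pairwiseDisjoint_subfamily {ι Q : Type} [Fintype ι] [DecidableEq ι] [DecidableEq Q]
    (S : ι → Finset Q) {s : ℕ} (hne : ∀ i, (S i).Nonempty) (hS : ∀ i, (S i).card ≤ s)
    (hback : ∀ q, (Finset.univ.filter fun i => q ∈ S i).card ≤ s) :
    ∃ I : Finset ι, (I : Set ι).PairwiseDisjoint S ∧ Fintype.card ι ≤ I.card * s ^ 2 := by
  classical
  obtain ⟨I, hI, hmax⟩ := Finset.exists_max_image
    (Finset.univ.filter fun I : Finset ι => (I : Set ι).PairwiseDisjoint S) Finset.card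
    ⟨∅, by simp⟩
  have hI' : (I : Set ι).PairwiseDisjoint S := (Finset.mem_filter.mp hI).2
  refine ⟨I, hI', ?_⟩
  -- By maximality every set meets a chosen one; nonemptiness covers the chosen sets themselves.
  -- Each chosen set has at most s points, each lying in at most s sets, which gives the factor s².
  have hcover : (Finset.univ : Finset ι) ⊆
      I.biUnion fun i => (S i).biUnion fun q => Finset.univ.filter fun j => q ∈ S j := by
    intro j _
    suffices h : ∃ i ∈ I, ¬ Disjoint (S i) (S j) by
      obtain ⟨i, hi, hd⟩ := h
      obtain ⟨q, hq, hqj⟩ := Finset.not_disjoint_iff.mp hd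
      simp only [Finset.mem_biUnion]
      exact ⟨i, hi, q, hq, by simpa using hqj⟩
    by_contra! h
    by_cases hj : j ∈ I
    · exact (hne j).ne_empty (disjoint_self.mp (h j hj))
    · have hins : ((insert j I : Finset ι) : Set ι).PairwiseDisjoint S := by
        rw [Finset.coe_insert]
        exact hI'.insert fun i hi _ => (h i hi).symm
      have := hmax (insert j I) (by simpa using hins)
      rw [Finset.card_insert_of_notMem hj] at this
      omega
  calc Fintype.card ι ≤ _ := Finset.card_le_card hcover
    _ ≤ I.card * s ^ 2 := by
        refine Finset.card_biUnion_le_card_mul _ _ _ fun i _ => ?_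
        rw [sq]
        exact (Finset.card_biUnion_le_card_mul _ _ _ fun q _ => hback q).trans
          (Nat.mul_le_mul_right _ (hS i))

/-! ### The bound in terms of the size of the light cones -/

/-- Write z = my. Bernoulli's inequality gives (1-y)^m (1+z) ≤ (1-y²)^m ≤ 1, so z/(1+z) ≤ e. As e <
1/2 this forces z < 1, and then z/2 ≤ z/(1+z). -/
theorem half_mul_le_one_sub_pow {y e : ℝ} {m : ℕ} (hy0 : 0 ≤ y) (hy1 : y ≤ 1)
    (he : e < 1 / 2) (h : 1 - (1 - y) ^ m ≤ e) : m * y / 2 ≤ e := by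
  have hP0 : 0 ≤ (1 - y) ^ m := pow_nonneg (by linarith) m
  have hP : (1 - y) ^ m * (1 + m * y) ≤ 1 := by
    calc (1 - y) ^ m * (1 + m * y) ≤ (1 - y) ^ m * (1 + y) ^ m :=
          mul_le_mul_of_nonneg_left (one_add_mul_le_pow (by linarith) m) hP0
      _ = (1 - y ^ 2) ^ m := by rw [← mul_pow]; ring
      _ ≤ 1 := pow_le_one₀ (by nlinarith) (by nlinarith)
  have hz0 : 0 ≤ m * y := by positivity
  nlinarith

namespace EncodingCircuit

variable {n k d : ℕ} (C : EncodingCircuit n k d)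

/-- No input of the circuit reaches more than `s` outputs, and no output is reached from more than
`s` inputs. -/
def HasConeBound (s : ℕ) : Prop := by
  classical
  exact (∀ q, (Finset.univ.filter fun q' => Reaches C.layerList q q').card ≤ s) ∧
    ∀ q, (Finset.univ.filter fun q' => Reaches C.layerList.reverse q q').card ≤ s

theorem length_layerList : C.layerList.length = d := List.length_ofFn

theorem hasConeBound_two_pow : C.HasConeBound (2 ^ d) := by
  refine ⟨fun q => ?_, fun q => ?_⟩
  · simpa only [length_layerList] using card_reaches_le_two_pow C.layerList q
  · simpa only [List.length_reverse, length_layerList] using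
      card_reaches_le_two_pow C.layerList.reverse q

theorem IsDimensional.hasConeBound {C : EncodingCircuit n k d} {D : ℕ} (hC : C.IsDimensional D)
    (hd : 1 ≤ d) : C.HasConeBound ((2 * d) ^ D) := by
  obtain ⟨m, pos, hpos, hnn⟩ := hC
  have hls : NearestNeighborLayers pos C.layerList := by
    intro l hl
    obtain ⟨t, rfl⟩ := List.mem_ofFn.mp hl
    exact hnn t
  have hls' : NearestNeighborLayers pos C.layerList.reverse := fun l hl =>
    hls l (List.mem_reverse.mp hl)
  have hne : C.layerList ≠ [] := by
    rw [← List.length_pos_iff, length_layerList]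
    exact hd
  refine ⟨fun q => ?_, fun q => ?_⟩
  · simpa only [length_layerList] using card_reaches_le_grid hpos hls hne q
  · simpa only [List.length_reverse, length_layerList] using
      card_reaches_le_grid hpos hls' (by simpa using hne) q

theorem le_choiError_sq {p : ℝ} (hp0 : 0 < p) (hp1 : p ≤ 1) {s : ℕ} (hs : C.HasConeBound s)
    (hε : C.choiError p < 0.1) : 3 / 8 * k * p ^ s ≤ C.choiError p ^ 2 * s ^ 2 := by
  classical
  obtain ⟨I, hI, hcard⟩ := exists_pairwiseDisjoint_subfamily C.cone (s := s)
    (fun i => ⟨C.logical i, C.mem_cone.mpr (Reaches.refl _ _)⟩)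
    (fun i => by
      refine le_trans (Finset.card_le_card fun q hq => ?_) (hs.1 (C.logical i))
      simpa using C.mem_cone.mp hq)
    -- The inputs that influence a given output form its light cone in the reversed circuit.
    (fun q => by
      rw [← Finset.card_map C.logical]
      refine le_trans (Finset.card_le_card fun q' hq' => ?_) (hs.2 q)
      obtain ⟨i, hi, rfl⟩ := Finset.mem_map.mp hq'
      simpa using (C.mem_cone.mp (Finset.mem_filter.mp hi).2).reverse)
  rw [Fintype.card_fin] at hcard
  have hps : p ^ s ≤ 1 := pow_le_one₀ hp0.le hp1
  have hps0 : 0 < p ^ s := pow_pos hp0 s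
  have hF : C.choiFidelity (tensorPowerMap (depolarizing p)) ^ 2 ≤ (1 - 3 / 4 * p ^ s) ^ I.card := by
    refine (C.choiFidelity_sq_le hp0.le hp1 hI).trans ?_
    rw [← Finset.prod_const]
    refine Finset.prod_le_prod (fun i _ => ?_) fun i _ => ?_
    · linarith [pow_le_one₀ (n := (C.cone i).card) hp0.le hp1]
    · have : (C.cone i).card ≤ s := by
        refine le_trans (Finset.card_le_card fun q hq => ?_) (hs.1 (C.logical i))
        simpa using C.mem_cone.mp hq
      linarith [pow_le_pow_of_le_one hp0.le hp1 this]
  have hsq : 1 - (1 - 3 / 4 * p ^ s) ^ I.card ≤ C.choiError p ^ 2 := by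
    -- This ensures that the squared fidelity is at most 1, so the real square root in the Choi
    -- error is not truncated.
    have hle : (1 - 3 / 4 * p ^ s) ^ I.card ≤ 1 := pow_le_one₀ (by linarith) (by linarith)
    rw [choiError, Real.sq_sqrt (by linarith)]
    linarith
  have hε0 : 0 ≤ C.choiError p := Real.sqrt_nonneg _
  have h := half_mul_le_one_sub_pow (by positivity) (by linarith) (by nlinarith) hsq
  have hk : (k : ℝ) ≤ I.card * s ^ 2 := by exact_mod_cast hcard
  calc 3 / 8 * k * p ^ s ≤ 3 / 8 * (I.card * s ^ 2) * p ^ s := by gcongr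
    _ = I.card * (3 / 4 * p ^ s) / 2 * s ^ 2 := by ring
    _ ≤ _ := by gcongr

theorem choiError_pos_and_log_bound {p : ℝ} (hp0 : 0 < p) (hp1 : p ≤ 1) {s : ℕ} (hs0 : 1 ≤ s)
    (hs : C.HasConeBound s) (hk : 1 ≤ k) (hε : C.choiError p < 0.1) :
    0 < C.choiError p ∧
      Real.logb 2 (3 / (8 * C.choiError p ^ 2)) + Real.logb 2 k ≤
        s * Real.logb 2 (1 / p) + 2 * Real.logb 2 s := by
  have h := C.le_choiError_sq hp0 hp1 hs hε
  have hk0 : (0 : ℝ) < k := by exact_mod_cast hk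
  have hs0' : (0 : ℝ) < s := by exact_mod_cast hs0
  have hps0 : 0 < p ^ s := pow_pos hp0 s
  have hε0 : 0 < C.choiError p := by
    refine lt_of_le_of_ne (Real.sqrt_nonneg _) fun h0 => ?_
    rw [← h0] at h
    have : 0 < 3 / 8 * k * p ^ s := by positivity
    linarith
  refine ⟨hε0, ?_⟩
  have hlog : (s : ℝ) * Real.logb 2 (1 / p) + 2 * Real.logb 2 s =
      Real.logb 2 ((1 / p) ^ s * (s : ℝ) ^ 2) := by
    rw [Real.logb_mul (by positivity) (by positivity), Real.logb_pow, Real.logb_pow]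
    norm_num
  rw [hlog, ← Real.logb_mul (by positivity) (by positivity)]
  refine Real.logb_le_logb_of_le one_lt_two (by positivity) ?_
  rw [one_div, inv_pow, div_mul_eq_mul_div, div_le_iff₀ (by positivity), inv_mul_eq_div,
    div_mul_eq_mul_div, le_div_iff₀ hps0]
  linarith

theorem logb_choiError_add_logb_nonneg {p : ℝ} (hk : 1 ≤ k) (hε0 : 0 < C.choiError p)
    (hε : C.choiError p < 0.1) :
    0 < Real.logb 2 (3 / (8 * C.choiError p ^ 2)) ∧ 0 ≤ Real.logb 2 k := by
  refine ⟨Real.logb_pos one_lt_two ?_, Real.logb_nonneg one_lt_two (by exact_mod_cast hk)⟩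
  rw [lt_div_iff₀ (by positivity)]
  nlinarith

theorem bound_dimensional {p : ℝ} (hp0 : 0 < p) (hp1 : p ≤ 1) {D : ℕ} (hC : C.IsDimensional D)
    (hk : 1 ≤ k) (hd : 1 ≤ d) (hε : C.choiError p < 0.1) :
    0 < C.choiError p ∧
      (2 * (d : ℝ)) ^ D * Real.logb 2 (1 / p) + 2 * D * Real.logb 2 (2 * d) ≥
        Real.logb 2 (3 / (8 * C.choiError p ^ 2)) + Real.logb 2 k := by
  have h := C.choiError_pos_and_log_bound hp0 hp1 (Nat.one_le_pow D (2 * d) (by omega))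
    (hC.hasConeBound hd) hk hε
  refine ⟨h.1, h.2.trans (le_of_eq ?_)⟩
  push_cast
  rw [Real.logb_pow]
  ring

theorem bound_allToAll {p : ℝ} (hp0 : 0 < p) (hp1 : p ≤ 1) (hk : 1 ≤ k)
    (hε : C.choiError p < 0.1) :
    0 < C.choiError p ∧
      (2 : ℝ) ^ d * Real.logb 2 (1 / p) + 2 * d ≥
        Real.logb 2 (3 / (8 * C.choiError p ^ 2)) + Real.logb 2 k := by
  have h := C.choiError_pos_and_log_bound hp0 hp1 Nat.one_le_two_pow C.hasConeBound_two_pow hk hε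
  refine ⟨h.1, h.2.trans (le_of_eq ?_)⟩
  push_cast
  rw [Real.logb_pow, Real.logb_self_eq_one one_lt_two, mul_one]

/-- A form linear in d, obtained from the crude estimate log(2d) ≤ 2d, that suffices for the Ω(log
n) statements. The constant term accommodates depth zero, where the all-to-all bound is used. -/
theorem bound_oneDimensional {p : ℝ} (hp0 : 0 < p) (hp1 : p ≤ 1) (hC : C.IsDimensional 1)
    (hk : 1 ≤ k) (hε : C.choiError p < 0.1) :
    Real.logb 2 (3 / (8 * C.choiError p ^ 2)) + Real.logb 2 k ≤
      (2 * Real.logb 2 (1 / p) + 4) * d + Real.logb 2 (1 / p) := by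
  have hL : 0 ≤ Real.logb 2 (1 / p) :=
    Real.logb_nonneg one_lt_two (by rw [le_div_iff₀ hp0]; linarith)
  rcases Nat.eq_zero_or_pos d with rfl | hd
  · have h := (C.bound_allToAll hp0 hp1 hk hε).2
    simpa using h
  · have h := (C.bound_dimensional hp0 hp1 hC hk hd hε).2
    have hd0 : (0 : ℝ) < d := by exact_mod_cast hd
    have hlog : Real.logb 2 (2 * d) ≤ 2 * d := by
      rw [Real.logb_le_iff_le_rpow one_lt_two (by positivity)]
      have := (Nat.lt_two_pow_self (n := 2 * d)).le
      rw [show (2 * d : ℝ) = ((2 * d : ℕ) : ℝ) by push_cast; ring, Real.rpow_natCast]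
      exact_mod_cast this
    simp only [pow_one, Nat.cast_one, mul_one] at h
    linarith

end EncodingCircuit

/-! ### Asymptotics -/

theorem tendsto_logb_two_mul_div_pow (L : ℝ) {D : ℕ} (hD : 1 ≤ D) :
    Filter.Tendsto (fun d : ℕ => 2 * D * Real.logb 2 (2 * d) / ((2 * (d : ℝ)) ^ D * L))
      Filter.atTop (nhds 0) := by
  have h1 : Filter.Tendsto (fun x : ℝ => Real.log x / x ^ (D : ℝ)) Filter.atTop (nhds 0) :=
    (isLittleO_log_rpow_atTop (by exact_mod_cast hD)).tendsto_div_nhds_zero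
  have h2 : Filter.Tendsto (fun d : ℕ => 2 * (d : ℝ)) Filter.atTop Filter.atTop :=
    tendsto_natCast_atTop_atTop.const_mul_atTop two_pos
  have h3 := (h1.comp h2).const_mul (2 * D / (Real.log 2 * L))
  rw [mul_zero] at h3
  refine h3.congr fun d => ?_
  simp only [Function.comp_apply, Real.logb, Real.rpow_natCast]
  ring

theorem tendsto_two_mul_div_two_pow (L : ℝ) :
    Filter.Tendsto (fun d : ℕ => 2 * (d : ℝ) / (2 ^ d * L)) Filter.atTop (nhds 0) := by
  have h := (tendsto_pow_const_div_const_pow_of_one_lt 1 (one_lt_two (α := ℝ))).const_mul (2 / L)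
  rw [mul_zero] at h
  refine h.congr fun d => ?_
  rw [pow_one]
  ring

/-- Absorbs the lower-order term Z into a relative correction of the leading term; Z/(YL) serves as
the o(1). -/
theorem div_one_add_mul_le {X Y Z L : ℝ} (hY : 0 < Y) (hZ : 0 ≤ Z) (hL : 0 < L)
    (h : X ≤ Y * L + Z) : X / ((1 + Z / (Y * L)) * L) ≤ Y := by
  rw [div_le_iff₀ (by positivity)]
  refine h.trans (le_of_eq ?_)
  field_simp

theorem tendsto_logb_natCast_atTop :
    Filter.Tendsto (fun n : ℕ => Real.logb 2 n) Filter.atTop Filter.atTop :=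
  (Real.tendsto_logb_atTop one_lt_two).comp tendsto_natCast_atTop_atTop

end

/-! ### Depth lower bounds and their asymptotic forms -/

theorem mainTheorem4 (p : ℝ) (hp0 : 0 < p) (hp1 : p ≤ 1) :
    -- `D`-dimensional circuits: the bound, and its asymptotic form
    (∀ D : ℕ, 1 ≤ D →
      (∀ (n k d : ℕ) (C : EncodingCircuit n k d), 1 ≤ k → 1 ≤ d → C.IsDimensional D →
        C.choiError p < 0.1 →
          0 < C.choiError p ∧
          (2 * (d : ℝ)) ^ D * Real.logb 2 (1 / p) + 2 * D * Real.logb 2 (2 * d) ≥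
            Real.logb 2 (3 / (8 * C.choiError p ^ 2)) + Real.logb 2 k) ∧
      (∃ δ : ℕ → ℝ, (∀ d, 0 ≤ δ d) ∧ Filter.Tendsto δ Filter.atTop (nhds 0) ∧
        ∀ (n k d : ℕ) (C : EncodingCircuit n k d), 1 ≤ k → 1 ≤ d → C.IsDimensional D →
          C.choiError p < 0.1 →
            (d : ℝ) ≥ 1 / 2 *
              ((Real.logb 2 (3 / (8 * C.choiError p ^ 2)) + Real.logb 2 k) /
                ((1 + δ d) * Real.logb 2 (1 / p))) ^ (1 / (D : ℝ)))) ∧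
    -- all-to-all circuits: the bound, and its asymptotic form
    (∀ (n k d : ℕ) (C : EncodingCircuit n k d), 1 ≤ k → C.choiError p < 0.1 →
        0 < C.choiError p ∧
        (2 : ℝ) ^ d * Real.logb 2 (1 / p) + 2 * d ≥
          Real.logb 2 (3 / (8 * C.choiError p ^ 2)) + Real.logb 2 k) ∧
    (∃ δ : ℕ → ℝ, (∀ d, 0 ≤ δ d) ∧ Filter.Tendsto δ Filter.atTop (nhds 0) ∧
      ∀ (n k d : ℕ) (C : EncodingCircuit n k d), 1 ≤ k → C.choiError p < 0.1 →
        (d : ℝ) ≥ Real.logb 2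
          ((Real.logb 2 (3 / (8 * C.choiError p ^ 2)) + Real.logb 2 k) /
            ((1 + δ d) * Real.logb 2 (1 / p)))) ∧
    -- one-dimensional circuits need depth `Ω(log n)` for a polynomially small Choi error
    (∀ α A : ℝ, 0 < α → 0 < A → ∃ c : ℝ, 0 < c ∧ ∃ N : ℕ,
      ∀ (n k d : ℕ) (C : EncodingCircuit n k d), N ≤ n → 1 ≤ k → C.IsDimensional 1 →
        C.choiError p ≤ A * (n : ℝ) ^ (-α) → (d : ℝ) ≥ c * Real.logb 2 n) ∧
    -- one-dimensional circuits need depth `Ω(log n)` for a constant encoding rate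
    (∀ r : ℝ, 0 < r → ∃ c : ℝ, 0 < c ∧ ∃ N : ℕ,
      ∀ (n k d : ℕ) (C : EncodingCircuit n k d), N ≤ n → r * n ≤ k → C.IsDimensional 1 →
        C.choiError p < 0.1 → (d : ℝ) ≥ c * Real.logb 2 n) := by
  have hL : 0 ≤ Real.logb 2 (1 / p) :=
    Real.logb_nonneg one_lt_two (by rw [le_div_iff₀ hp0]; linarith)
  refine ⟨fun D hD => ⟨fun n k d C hk hd hC hε => C.bound_dimensional hp0 hp1 hC hk hd hε, ?_⟩,
    fun n k d C hk hε => C.bound_allToAll hp0 hp1 hk hε, ?_, ?_, ?_⟩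
  · refine ⟨fun d => 2 * D * Real.logb 2 (2 * d) / ((2 * (d : ℝ)) ^ D * Real.logb 2 (1 / p)),
      fun d => ?_, tendsto_logb_two_mul_div_pow _ hD, fun n k d C hk hd hC hε => ?_⟩
    · rcases Nat.eq_zero_or_pos d with rfl | hd
      · simp
      · have hd1 : (1 : ℝ) ≤ d := by exact_mod_cast hd
        have := Real.logb_nonneg one_lt_two (show (1 : ℝ) ≤ 2 * d by linarith)
        positivity
    · have hb := C.bound_dimensional hp0 hp1 hC hk hd hε
      have hX := C.logb_choiError_add_logb_nonneg hk hb.1 hε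
      have hd1 : (1 : ℝ) ≤ d := by exact_mod_cast hd
      have hlog := Real.logb_nonneg one_lt_two (show (1 : ℝ) ≤ 2 * d by linarith)
      have hD0 : D ≠ 0 := by omega
      rcases hL.eq_or_lt with hL0 | hL0
      -- For p = 1 the denominator is zero; the quotient and its root are then 0 by convention and
      -- the bound is trivial.
      · rw [← hL0, mul_zero, div_zero, Real.zero_rpow (by positivity)]
        linarith
      · have h := div_one_add_mul_le (by positivity) (by positivity) hL0 hb.2
        have h' := Real.rpow_le_rpow (div_nonneg (by linarith) (by positivity)) h
          (by positivity : (0 : ℝ) ≤ 1 / D)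
        rw [one_div (D : ℝ), Real.pow_rpow_inv_natCast (by positivity) hD0, ← one_div] at h'
        linarith
  · refine ⟨fun d => 2 * (d : ℝ) / (2 ^ d * Real.logb 2 (1 / p)), fun d => by positivity,
      tendsto_two_mul_div_two_pow _, fun n k d C hk hε => ?_⟩
    have hb := C.bound_allToAll hp0 hp1 hk hε
    have hX := C.logb_choiError_add_logb_nonneg hk hb.1 hε
    rcases hL.eq_or_lt with hL0 | hL0
    · rw [← hL0, mul_zero, div_zero, Real.logb_zero]
      positivity
    · have h := div_one_add_mul_le (by positivity) (by positivity) hL0 hb.2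
      have h' := Real.logb_le_logb_of_le one_lt_two
        (div_pos (by linarith) (by positivity)) h
      rwa [Real.logb_pow, Real.logb_self_eq_one one_lt_two, mul_one] at h'
  · intro α A hα hA
    set L := Real.logb 2 (1 / p) with hLdef
    -- The error term supplies 2α log n up to a constant. For large n, half of it absorbs that
    -- constant and `L`, leaving α log n.
    refine ⟨α / (2 * L + 4), by positivity, ?_⟩
    have h1 : ∀ᶠ n : ℕ in Filter.atTop, A * (n : ℝ) ^ (-α) < 0.1 := by
      have h := ((tendsto_rpow_neg_atTop hα).comp tendsto_natCast_atTop_atTop).const_mul A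
      rw [mul_zero] at h
      exact h.eventually_lt_const (by norm_num)
    have h2 := tendsto_logb_natCast_atTop.eventually_ge_atTop
      ((L - Real.logb 2 (3 / (8 * A ^ 2))) / α)
    obtain ⟨N, hN⟩ := Filter.eventually_atTop.mp (h1.and (h2.and (Filter.eventually_ge_atTop 1)))
    refine ⟨N, fun n k d C hn hk hC hε => ?_⟩
    obtain ⟨hn1, hn2, hn3⟩ := hN n hn
    have hε' := hε.trans_lt hn1
    have hb := C.bound_oneDimensional hp0 hp1 hC hk hε'
    have hε0 := (C.bound_allToAll hp0 hp1 hk hε').1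
    have hk0 := (C.logb_choiError_add_logb_nonneg hk hε0 hε').2
    have hn0 : (0 : ℝ) < n := by exact_mod_cast hn3
    have hlog : Real.logb 2 (3 / (8 * A ^ 2)) + 2 * α * Real.logb 2 n ≤
        Real.logb 2 (3 / (8 * C.choiError p ^ 2)) := by
      have h : 3 / (8 * (A * (n : ℝ) ^ (-α)) ^ 2) ≤ 3 / (8 * C.choiError p ^ 2) := by gcongr
      refine le_trans (le_of_eq ?_) (Real.logb_le_logb_of_le one_lt_two (by positivity) h)
      rw [show 3 / (8 * (A * (n : ℝ) ^ (-α)) ^ 2) = 3 / (8 * A ^ 2) / ((n : ℝ) ^ (-α)) ^ 2 by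
          field_simp,
        Real.logb_div (x := 3 / (8 * A ^ 2)) (by positivity) (by positivity), Real.logb_pow,
        Real.logb_rpow_eq_mul_logb_of_pos hn0]
      push_cast
      ring
    rw [div_le_iff₀ hα] at hn2
    rw [ge_iff_le, div_mul_eq_mul_div, div_le_iff₀ (by positivity)]
    linarith
  · intro r hr
    set L := Real.logb 2 (1 / p) with hLdef
    -- The rate gives log k ≥ log n + log r, and half of log n absorbs `L` and log r for large n.
    -- The error term is only used to be positive.
    refine ⟨2⁻¹ / (2 * L + 4), by positivity, ?_⟩
    have h2 := tendsto_logb_natCast_atTop.eventually_ge_atTop (2 * (L - Real.logb 2 r))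
    obtain ⟨N, hN⟩ := Filter.eventually_atTop.mp (h2.and (Filter.eventually_ge_atTop 1))
    refine ⟨N, fun n k d C hn hk hC hε => ?_⟩
    obtain ⟨hn2, hn3⟩ := hN n hn
    have hn0 : (0 : ℝ) < n := by exact_mod_cast hn3
    have hk1 : 1 ≤ k := by
      have : (0 : ℝ) < k := lt_of_lt_of_le (by positivity) hk
      exact_mod_cast this
    have hb := C.bound_oneDimensional hp0 hp1 hC hk1 hε
    have hε0 := (C.bound_allToAll hp0 hp1 hk1 hε).1
    have hX := (C.logb_choiError_add_logb_nonneg hk1 hε0 hε).1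
    have hlog : Real.logb 2 r + Real.logb 2 n ≤ Real.logb 2 k := by
      rw [← Real.logb_mul hr.ne' hn0.ne']
      exact Real.logb_le_logb_of_le one_lt_two (by positivity) hk
    rw [ge_iff_le, div_mul_eq_mul_div, div_le_iff₀ (by positivity)]
    linarith
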